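/- Let $d\ge 2$, let $\Omega\subseteq\mathbb R^d$ be a bounded domain, $T_0>0$, and let $f\in C^\infty(\mathbb R)$ satisfy $f'(\pm1)=0$, $f''(\pm1)>0$ and $f(s)=f(-s)>0$ for $s\in(-1,1)$. Let $\theta_0\in C^2(\mathbb R)$ be the optimal profile, i.e. $-\theta_0''+f'(\theta_0)=0$ on $\mathbb R$, $\lim_{\rho\to\pm\infty}\theta_0(\rho)=\pm1$, $\theta_0(0)=0$. Let $(\Gamma_t)_{t\in[0,T_0]}$ be a smoothly evolving family of non-empty, closed and compact $C^\infty$-hypersurfaces $\Gamma_t\subseteq\Omega$; that is, $\Gamma=\bigcup_{t\in[0,T_0]}\Gamma_t\times\{t\}$ is compact and, near each of its points, $\Gamma$ is the zero set (for $t\in[0,T_0]$) of a smooth function of $(x,t)$ whose $x$-gradient does not vanish. Let $\Omega\setminus\Gamma_t$ be the disjoint union of open sets $\Omega^+(t)$, $\Omega^-(t)$ with $\partial\Omega^\pm(t)\cap\Omega=\Gamma_t$. Let $d_\Gamma(x,t)=-\operatorname{dist}(x,\Gamma_t)$ for $x\in\Omega^-(t)$ and $d_\Gamma(x,t)=\operatorname{dist}(x,\Gamma_t)$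 otherwise, and for $r>0$ let $\Gamma_t(r)=\{y\in\Omega:\operatorname{dist}(y,\Gamma_t)<r\}$. Let $\delta>0$ be so small that every $x\in\Gamma_t(3\delta)$ has a unique nearest point $P_{\Gamma_t}(x)$ in $\Gamma_t$, that $d_\Gamma$ is $C^\infty$ on $\bigcup_{t\in[0,T_0]}\Gamma_t(3\delta)\times\{t\}$, and that $\operatorname{dist}(\Gamma_t,\partial\Omega)>2\delta$, for all $t\in[0,T_0]$. Let $\mathbf n_{\Gamma_t}(p)=\nabla d_\Gamma(p,t)$, $p\in\Gamma_t$, be the unit normal of $\Gamma_t$ exterior to $\Omega^-(t)$, and for $x\in\Gamma_t(3\delta)$ let $\nabla_{\boldsymbol\tau}\psi(x)=(I-\mathbf n\otimes\mathbf n)\nabla\psi(x)$ with $\mathbf n=\mathbf n_{\Gamma_t}(P_{\Gamma_t}(x))$. Then for every $M>0$ there are $C>0$ and $\varepsilon_0\in(0,1)$, depending only on $d$, $f$, $\Omega$, $T_0$, the families $\Gamma_t$, $\Omega^\pm(t)$, $\delta$ and $M$, such that the following holds. Let $\zeta\in C^\infty(\mathbb R)$ with $\zeta(s)=1$ for $|s|\le\delta$,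 $\zeta(s)=0$ for $|s|\ge2\delta$ and $0\le -s\zeta'(s)\le4$ for $\delta\le|s|\le2\delta$. For $\varepsilon\in(0,1)$ let $\tilde h_\varepsilon\colon\Gamma\to\mathbb R$ be continuous and let $c_{A,2+}=c_{A,2+}^\varepsilon\colon\Omega\times[0,T_0]\to\mathbb R$ be measurable in $x$ for each $t$, with $$\sup_{\varepsilon\in(0,1)}\Big(\sup_{(p,t)\in\Gamma}|\tilde h_\varepsilon(p,t)|+\sup_{x\in\Omega,\,t\in[0,T_0]}|c_{A,2+}(x,t)|\Big)\le M,$$ and put $$c_A=\zeta(d_\Gamma)\,\theta_0(\rho)+(1-\zeta(d_\Gamma))\big(\chi_{\Omega^+(t)}-\chi_{\Omega^-(t)}\big)+\varepsilon^2c_{A,2+},\qquad \rho=\frac{d_\Gamma(x,t)}{\varepsilon}-\tilde h_\varepsilon(P_{\Gamma_t}(x),t).$$ Then for every $\psi\in H^1(\Omega)$, $t\in[0,T_0]$ and $\varepsilon\in(0,\varepsilon_0]$, $$\int_\Omega\Big(|\nabla\psi|^2+\varepsilon^{-2}f''(c_A(x,t))\,\psi^2\Big)\,dx\ \ge\ -C\int_\Omega\psi^2\,dx+\int_{\Omega\setminus\Gamma_t(\delta)}|\nabla\psi|^2\,dx+\int_{\Gamma_t(\delta)}|\nabla_{\boldsymbol\tau}\psi|^2\,dx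 .$$ -/

import Mathlib

open Set MeasureTheory Filter Topology
open scoped ContDiff

namespace AllenCahn

/-- The double well potential: `f` is smooth, `f'(±1) = 0`, `f''(±1) > 0`, and
`f(s) = f(-s) > 0` on `(-1, 1)`. -/
structure IsDoubleWell (f : ℝ → ℝ) : Prop where
  smooth : ContDiff ℝ ∞ f
  deriv_one : deriv f 1 = 0
  deriv_neg_one : deriv f (-1) = 0
  deriv2_one : 0 < deriv (deriv f) 1
  deriv2_neg_one : 0 < deriv (deriv f) (-1)
  even : ∀ s ∈ Ioo (-1 : ℝ) 1, f s = f (-s)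
  pos : ∀ s ∈ Ioo (-1 : ℝ) 1, 0 < f s

/-- The optimal profile: `-θ₀'' + f'(θ₀) = 0` on `ℝ`, `θ₀ → ±1` at `±∞`, `θ₀(0) = 0`. -/
structure IsOptimalProfile (f θ₀ : ℝ → ℝ) : Prop where
  contDiff : ContDiff ℝ 2 θ₀
  ode : ∀ ρ, -deriv (deriv θ₀) ρ + deriv f (θ₀ ρ) = 0
  tendsto_top : Tendsto θ₀ atTop (𝓝 1)
  tendsto_bot : Tendsto θ₀ atBot (𝓝 (-1))
  zero : θ₀ 0 = 0

/-- The cut-off function: `ζ` is smooth, `ζ = 1` on `|s| ≤ δ`, `ζ = 0` on `|s| ≥ 2δ` and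
`0 ≤ -s ζ'(s) ≤ 4` on `δ ≤ |s| ≤ 2δ`. -/
structure IsCutoff (δ : ℝ) (ζ : ℝ → ℝ) : Prop where
  smooth : ContDiff ℝ ∞ ζ
  eq_one : ∀ s, |s| ≤ δ → ζ s = 1
  eq_zero : ∀ s, 2 * δ ≤ |s| → ζ s = 0
  slope : ∀ s, δ ≤ |s| → |s| ≤ 2 * δ → 0 ≤ -s * deriv ζ s ∧ -s * deriv ζ s ≤ 4

/-- The space-time interface `⋃_{t ∈ [0,T₀]} Γ_t × {t}`. -/
def spaceTime {d : ℕ} (Γ : ℝ → Set (EuclideanSpace ℝ (Fin d))) (T₀ : ℝ) :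
    Set (EuclideanSpace ℝ (Fin d) × ℝ) :=
  {q | q.2 ∈ Icc 0 T₀ ∧ q.1 ∈ Γ q.2}

/-- `(Γ_t)_{t ∈ [0,T₀]}` is a smoothly evolving family of closed and compact `C^∞` hypersurfaces
contained in `Ω`: the space-time interface is compact and is locally, over `[0,T₀]`, the zero set
of a smooth function of `(x, t)` whose gradient with respect to `x` does not vanish. -/
structure IsEvolvingHypersurface {d : ℕ} (Ω : Set (EuclideanSpace ℝ (Fin d))) (T₀ : ℝ)
    (Γ : ℝ → Set (EuclideanSpace ℝ (Fin d))) : Prop where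
  subset : ∀ t ∈ Icc 0 T₀, Γ t ⊆ Ω
  nonempty : ∀ t ∈ Icc 0 T₀, (Γ t).Nonempty
  compact : IsCompact (spaceTime Γ T₀)
  smooth : ∀ q ∈ spaceTime Γ T₀, ∃ U : Set (EuclideanSpace ℝ (Fin d) × ℝ),
    ∃ φ : EuclideanSpace ℝ (Fin d) × ℝ → ℝ, IsOpen U ∧ q ∈ U ∧ ContDiffOn ℝ ∞ φ U ∧
      (∀ y ∈ U, y.2 ∈ Icc 0 T₀ → (y.1 ∈ Γ y.2 ↔ φ y = 0)) ∧
      (∀ y ∈ U, gradient (fun x => φ (x, y.2)) y.1 ≠ 0)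

/-- `Γ_t` divides `Ω` into the disjoint open sets `Ω⁺(t)` and `Ω⁻(t)`, and is the boundary of each
of them inside `Ω`. -/
structure IsDivided {d : ℕ} (Ω : Set (EuclideanSpace ℝ (Fin d))) (T₀ : ℝ)
    (Γ Ωp Ωm : ℝ → Set (EuclideanSpace ℝ (Fin d))) : Prop where
  isOpen_plus : ∀ t ∈ Icc 0 T₀, IsOpen (Ωp t)
  isOpen_minus : ∀ t ∈ Icc 0 T₀, IsOpen (Ωm t)
  disjoint : ∀ t ∈ Icc 0 T₀, Disjoint (Ωp t) (Ωm t)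
  union : ∀ t ∈ Icc 0 T₀, Ωp t ∪ Ωm t = Ω \ Γ t
  frontier_plus : ∀ t ∈ Icc 0 T₀, frontier (Ωp t) ∩ Ω = Γ t
  frontier_minus : ∀ t ∈ Icc 0 T₀, frontier (Ωm t) ∩ Ω = Γ t

open Classical in
/-- The signed distance `d_Γ(x,t)` to `Γ_t`: negative in `Ω⁻(t)`, nonnegative elsewhere. -/
noncomputable def sdist {d : ℕ} (Γ Ωm : ℝ → Set (EuclideanSpace ℝ (Fin d)))
    (x : EuclideanSpace ℝ (Fin d)) (t : ℝ) : ℝ :=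
  if x ∈ Ωm t then -Metric.infDist x (Γ t) else Metric.infDist x (Γ t)

/-- The tubular neighbourhood `Γ_t(r) = {y ∈ Ω : dist(y, Γ_t) < r}`. -/
def tube {d : ℕ} (Ω : Set (EuclideanSpace ℝ (Fin d)))
    (Γ : ℝ → Set (EuclideanSpace ℝ (Fin d))) (r t : ℝ) : Set (EuclideanSpace ℝ (Fin d)) :=
  {y | y ∈ Ω ∧ Metric.infDist y (Γ t) < r}

/-- The width `δ > 0` is small enough: on `Γ(3δ)` the orthogonal projection is well defined and
the signed distance is smooth, and `dist(Γ_t, ∂Ω) > 2δ`. -/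
structure IsTubeWidth {d : ℕ} (Ω : Set (EuclideanSpace ℝ (Fin d))) (T₀ : ℝ)
    (Γ Ωm : ℝ → Set (EuclideanSpace ℝ (Fin d))) (δ : ℝ) : Prop where
  pos : 0 < δ
  unique_nearest : ∀ t ∈ Icc 0 T₀, ∀ x ∈ tube Ω Γ (3 * δ) t,
    ∃! p, p ∈ Γ t ∧ dist x p = Metric.infDist x (Γ t)
  smooth : ContDiffOn ℝ ∞ (fun q : EuclideanSpace ℝ (Fin d) × ℝ => sdist Γ Ωm q.1 q.2)
    {q | q.2 ∈ Icc 0 T₀ ∧ q.1 ∈ tube Ω Γ (3 * δ) q.2}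
  far_from_boundary : ∀ t ∈ Icc 0 T₀, ∀ p ∈ Γ t, ∀ q ∈ frontier Ω, 2 * δ < dist p q

/-- The orthogonal projection `P_{Γ_t}(x)`: a nearest point of `Γ_t` (the only one on `Γ(3δ)`). -/
noncomputable def proj {d : ℕ} (Γ : ℝ → Set (EuclideanSpace ℝ (Fin d)))
    (x : EuclideanSpace ℝ (Fin d)) (t : ℝ) : EuclideanSpace ℝ (Fin d) :=
  Classical.epsilon fun p => p ∈ Γ t ∧ dist x p = Metric.infDist x (Γ t)

/-- The unit normal of `Γ_t` at `p ∈ Γ_t`, exterior to `Ω⁻(t)`: `n_{Γ_t}(p) = ∇ d_Γ(p, t)`. -/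
noncomputable def normal {d : ℕ} (Γ Ωm : ℝ → Set (EuclideanSpace ℝ (Fin d)))
    (p : EuclideanSpace ℝ (Fin d)) (t : ℝ) : EuclideanSpace ℝ (Fin d) :=
  gradient (fun y => sdist Γ Ωm y t) p

/-- The tangential part `(I - n ⊗ n) v` of a vector `v` at `x`, where `n = n_{Γ_t}(P_{Γ_t}(x))`.
For `v = ∇ψ(x)` this is `∇_τ ψ(x)`. -/
noncomputable def tangential {d : ℕ} (Γ Ωm : ℝ → Set (EuclideanSpace ℝ (Fin d)))
    (x : EuclideanSpace ℝ (Fin d)) (t : ℝ) (v : EuclideanSpace ℝ (Fin d)) :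
    EuclideanSpace ℝ (Fin d) :=
  v - inner ℝ (normal Γ Ωm (proj Γ x t) t) v • normal Γ Ωm (proj Γ x t) t

/-- The stretched variable `ρ = d_Γ(x,t)/ε - h(P_{Γ_t}(x), t)`. -/
noncomputable def stretched {d : ℕ} (Γ Ωm : ℝ → Set (EuclideanSpace ℝ (Fin d)))
    (h : EuclideanSpace ℝ (Fin d) → ℝ → ℝ) (ε : ℝ) (x : EuclideanSpace ℝ (Fin d)) (t : ℝ) : ℝ :=
  sdist Γ Ωm x t / ε - h (proj Γ x t) t

/-- `c_{A,0} = ζ(d_Γ) θ₀(ρ) + (1 - ζ(d_Γ)) (χ_{Ω⁺(t)} - χ_{Ω⁻(t)})`. -/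
noncomputable def cA₀ {d : ℕ} (θ₀ ζ : ℝ → ℝ) (Γ Ωp Ωm : ℝ → Set (EuclideanSpace ℝ (Fin d)))
    (h : EuclideanSpace ℝ (Fin d) → ℝ → ℝ) (ε : ℝ) (x : EuclideanSpace ℝ (Fin d)) (t : ℝ) : ℝ :=
  ζ (sdist Γ Ωm x t) * θ₀ (stretched Γ Ωm h ε x t) +
    (1 - ζ (sdist Γ Ωm x t)) *
      ((Ωp t).indicator (fun _ => (1 : ℝ)) x - (Ωm t).indicator (fun _ => (1 : ℝ)) x)

/-- `c_A = c_{A,0} + ε² c_{A,2+}`. -/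
noncomputable def cA {d : ℕ} (θ₀ ζ : ℝ → ℝ) (Γ Ωp Ωm : ℝ → Set (EuclideanSpace ℝ (Fin d)))
    (h c₂ : EuclideanSpace ℝ (Fin d) → ℝ → ℝ) (ε : ℝ) (x : EuclideanSpace ℝ (Fin d)) (t : ℝ) : ℝ :=
  cA₀ θ₀ ζ Γ Ωp Ωm h ε x t + ε ^ 2 * c₂ x t

/-- `ψ ∈ H¹(Ω)` with weak gradient `∇ψ = G`. -/
structure IsH1 {d : ℕ} (Ω : Set (EuclideanSpace ℝ (Fin d))) (ψ : EuclideanSpace ℝ (Fin d) → ℝ)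
    (G : EuclideanSpace ℝ (Fin d) → EuclideanSpace ℝ (Fin d)) : Prop where
  memLp : MemLp ψ 2 (volume.restrict Ω)
  memLp_grad : MemLp G 2 (volume.restrict Ω)
  weak : ∀ φ : EuclideanSpace ℝ (Fin d) → ℝ, ContDiff ℝ ∞ φ → HasCompactSupport φ →
    tsupport φ ⊆ Ω → ∀ v : EuclideanSpace ℝ (Fin d),
      (∫ x in Ω, ψ x * fderiv ℝ φ x v) = -(∫ x in Ω, inner ℝ (G x) v * φ x)

end AllenCahn

/-!
The estimate is proved by a calibration argument. Write `n = ∇ d_Γ`. If a function `g` vanishes at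
distance at least `δ` from `Γ_t`, then integrating `(∂ₙψ - g ψ)² ≥ 0` over the tube and using
`∇(ψ²) = 2 ψ ∇ψ` gives

  `∫_{Γ_t(δ)} |∂ₙψ|² ≥ -∫_Ω (div (g n) + g²) ψ²`,

so it suffices to find `g` with `div (g n) + g² ≤ ε⁻² f''(c_A) + C` on `Ω`
(`IsTubularSetting.calibration`). No coordinates on the tube are needed, and only the normal part
of the gradient is used up.

The choice of `g` (`fieldWeight`) rests on the ground state `θ₀'` of the one-dimensional operator
`-∂² + f''(θ₀)`. It has no zeros, because the profile would otherwise be symmetric about the zero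
(`IsOptimalProfile.deriv_ne_zero`), so its logarithmic derivative `q = θ₀''/θ₀'` solves the Riccati
equation `q' + q² = f''(θ₀)`. In the normal direction `ρ` has slope `1/ε`, because the nearest point
`x - d_Γ ∇ d_Γ` does not move (`IsTubularSetting.fderiv_smoothStretched`); hence
`g = ε⁻¹ q(ρ) - Δ d_Γ / 2` satisfies `div (g n) + g² = ε⁻² f''(θ₀(ρ)) + O(1)`, the second summand
cancelling the curvature term `ε⁻¹ q(ρ) Δ d_Γ`, which is of order `1/ε`. The cut-off is
`η = cos² β`, for which completing a square absorbs the derivative of `η` without any bound on `q`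
(`IsTubularSetting.fderiv_fieldWeight_add_le`); it equals `1` where `f''(θ₀(ρ))` may be negative
(`IsTubularSetting.cos_sq_mul_potential_le`).

The height function is merely continuous along `Γ_t`, so for fixed `ε` and `t` it is first replaced
by a smooth function so close to it that `θ₀(ρ)` changes by at most `ε²`
(`IsTubularSetting.exists_smoothStretched`), which costs a bounded amount in the potential. Outside
the tube `c_A` is close to `±1` and `f''(c_A) ≥ 0`. The constants are uniform in time because the
closed tubes form a compact set in space-time, on which the `x`-derivatives of `d_Γ` are continuous
(`IsTubularSetting.exists_bound_fderiv_lapSdist`). For `ψ` in `H¹` the product rule for `ψ²` follows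
by testing with a mollification of `ψ` times a smooth function (`IsH1.integral_sq_mul_fderiv`).
-/

namespace AllenCahn

/-! ### The optimal profile -/

section Profile

variable {f θ₀ : ℝ → ℝ}

lemma IsDoubleWell.contDiff_deriv (hf : IsDoubleWell f) : ContDiff ℝ ∞ (deriv f) :=
  (contDiff_infty_iff_deriv.1 hf.smooth).2

lemma IsDoubleWell.contDiff_deriv2 (hf : IsDoubleWell f) : ContDiff ℝ ∞ (deriv (deriv f)) :=
  (contDiff_infty_iff_deriv.1 hf.contDiff_deriv).2

/-- The profile inherits the smoothness of `f` through its differential equation. -/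
lemma IsOptimalProfile.contDiff_top (hf : IsDoubleWell f) (hθ : IsOptimalProfile f θ₀) :
    ContDiff ℝ ∞ θ₀ := by
  have hode : deriv (deriv θ₀) = deriv f ∘ θ₀ := by
    ext ρ; have := hθ.ode ρ; simp only [Function.comp]; linarith
  have h1 : Differentiable ℝ θ₀ := hθ.contDiff.differentiable (by norm_num)
  have h2 : Differentiable ℝ (deriv θ₀) := by
    have : ContDiff ℝ (1 + 1) θ₀ := hθ.contDiff
    exact (contDiff_succ_iff_deriv.1 this).2.2.differentiable (by norm_num)
  have step : ∀ n : ℕ, ContDiff ℝ n θ₀ := by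
    intro n
    induction n with
    | zero => exact contDiff_zero.2 h1.continuous
    | succ n ih =>
      have h3 : ContDiff ℝ (n + 1) (deriv θ₀) := by
        refine contDiff_succ_iff_deriv.2 ⟨h2, by simp, ?_⟩
        rw [hode]
        exact (hf.contDiff_deriv.of_le (by exact_mod_cast le_top)).comp ih
      have : ContDiff ℝ ((n : WithTop ℕ∞) + 1) θ₀ :=
        contDiff_succ_iff_deriv.2 ⟨h1, by simp, h3.of_le (by exact_mod_cast Nat.le_succ n)⟩
      exact_mod_cast this
  exact _root_.contDiff_infty.2 step

lemma IsOptimalProfile.hasDerivAt (hf : IsDoubleWell f) (hθ : IsOptimalProfile f θ₀) (ρ : ℝ) :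
    HasDerivAt θ₀ (deriv θ₀ ρ) ρ :=
  ((hθ.contDiff_top hf).differentiable (by simp) ρ).hasDerivAt

lemma IsOptimalProfile.hasDerivAt_deriv (hf : IsDoubleWell f) (hθ : IsOptimalProfile f θ₀)
    (ρ : ℝ) : HasDerivAt (deriv θ₀) (deriv f (θ₀ ρ)) ρ := by
  have h := (contDiff_infty_iff_deriv.1 (hθ.contDiff_top hf)).2
  have := (h.differentiable (by simp) ρ).hasDerivAt
  have e := hθ.ode ρ
  rwa [show deriv (deriv θ₀) ρ = deriv f (θ₀ ρ) by linarith] at this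

/-- A critical point `a` of the profile would, by uniqueness for the differential equation, make
the profile symmetric about `a`, contradicting its different limits at `±∞`. -/
lemma IsOptimalProfile.deriv_ne_zero (hf : IsDoubleWell f) (hθ : IsOptimalProfile f θ₀) (a : ℝ) :
    deriv θ₀ a ≠ 0 := by
  intro ha
  have hsym : ∀ b : ℝ, 0 ≤ b → θ₀ (a + b) = θ₀ (a - b) := by
    intro b hb
    let v : ℝ → ℝ × ℝ → ℝ × ℝ := fun _ q => (q.2, deriv f q.1)
    let Y : ℝ → ℝ × ℝ := fun s => (θ₀ (a + s), deriv θ₀ (a + s))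
    let Z : ℝ → ℝ × ℝ := fun s => (θ₀ (a - s), -deriv θ₀ (a - s))
    have hY : ∀ s, HasDerivAt Y (v s (Y s)) s := fun s =>
      HasDerivAt.prodMk ((hθ.hasDerivAt hf (a + s)).comp_const_add a s)
        ((hθ.hasDerivAt_deriv hf (a + s)).comp_const_add a s)
    have hZ : ∀ s, HasDerivAt Z (v s (Z s)) s := fun s => by
      have h1 := (hθ.hasDerivAt hf (a - s)).comp_const_sub a s
      have h2 := ((hθ.hasDerivAt_deriv hf (a - s)).comp_const_sub a s).neg
      rw [neg_neg] at h2
      exact HasDerivAt.prodMk h1 h2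
    have hYc : Continuous Y := continuous_iff_continuousAt.2 fun s => (hY s).continuousAt
    have hZc : Continuous Z := continuous_iff_continuousAt.2 fun s => (hZ s).continuousAt
    have hK : IsCompact (Y '' Icc 0 b ∪ Z '' Icc 0 b) :=
      (isCompact_Icc.image hYc).union (isCompact_Icc.image hZc)
    have hv : ContDiff ℝ 1 (v 0) :=
      contDiff_snd.prodMk ((hf.contDiff_deriv.of_le (by simp)).comp contDiff_fst)
    obtain ⟨K, hKl⟩ := hv.locallyLipschitz.locallyLipschitzOn.exists_lipschitzOnWith_of_compact hK
    have := ODE_solution_unique_of_mem_Icc_right (v := v)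
      (s := fun _ => Y '' Icc 0 b ∪ Z '' Icc 0 b) (fun t _ => hKl)
      hYc.continuousOn (fun t _ => (hY t).hasDerivWithinAt)
      (fun t ht => Or.inl ⟨t, Ico_subset_Icc_self ht, rfl⟩)
      hZc.continuousOn (fun t _ => (hZ t).hasDerivWithinAt)
      (fun t ht => Or.inr ⟨t, Ico_subset_Icc_self ht, rfl⟩)
      (by simp [Y, Z, ha]) ⟨hb, le_rfl⟩
    exact congrArg Prod.fst this
  have h1 : Tendsto (fun b => θ₀ (a + b)) atTop (𝓝 1) :=
    hθ.tendsto_top.comp (tendsto_atTop_add_const_left _ a tendsto_id)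
  have h2 : Tendsto (fun b => θ₀ (a - b)) atTop (𝓝 (-1)) :=
    hθ.tendsto_bot.comp (tendsto_atBot_add_const_left _ a tendsto_neg_atTop_atBot)
  have h3 : (fun b => θ₀ (a + b)) =ᶠ[atTop] fun b => θ₀ (a - b) :=
    (eventually_ge_atTop 0).mono hsym
  have := tendsto_nhds_unique (h1.congr' h3) h2
  norm_num at this

/-- The logarithmic derivative `θ₀'' / θ₀'` of `θ₀'`. -/
noncomputable def logDerivProfile (θ₀ : ℝ → ℝ) (ρ : ℝ) : ℝ := deriv (deriv θ₀) ρ / deriv θ₀ ρ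

lemma IsOptimalProfile.contDiff_logDerivProfile (hf : IsDoubleWell f)
    (hθ : IsOptimalProfile f θ₀) : ContDiff ℝ ∞ (logDerivProfile θ₀) := by
  have h1 := (contDiff_infty_iff_deriv.1 (hθ.contDiff_top hf)).2
  exact (contDiff_infty_iff_deriv.1 h1).2.div h1 (hθ.deriv_ne_zero hf)

/-- The Riccati equation satisfied by the logarithmic derivative of `θ₀'`, which is in the kernel
of the linearised operator `-∂² + f''(θ₀)`. -/
lemma IsOptimalProfile.hasDerivAt_logDerivProfile (hf : IsDoubleWell f)
    (hθ : IsOptimalProfile f θ₀) (ρ : ℝ) :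
    HasDerivAt (logDerivProfile θ₀)
      (deriv (deriv f) (θ₀ ρ) - logDerivProfile θ₀ ρ ^ 2) ρ := by
  have hode : deriv (deriv θ₀) = fun ρ => deriv f (θ₀ ρ) := by
    ext ρ; have := hθ.ode ρ; linarith
  have h0 := hθ.deriv_ne_zero hf ρ
  have h1 : HasDerivAt (fun ρ => deriv f (θ₀ ρ)) (deriv (deriv f) (θ₀ ρ) * deriv θ₀ ρ) ρ :=
    ((hf.contDiff_deriv.differentiable (by simp) (θ₀ ρ)).hasDerivAt).comp ρ (hθ.hasDerivAt hf ρ)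
  have h2 := h1.div (hθ.hasDerivAt_deriv hf ρ) h0
  have e : logDerivProfile θ₀ = (fun ρ => deriv f (θ₀ ρ)) / deriv θ₀ := by
    ext ρ; simp [logDerivProfile, hode]
  rw [e]
  refine h2.congr_deriv ?_
  simp only [Pi.div_apply]
  field_simp

/-- `f''` is nonnegative near the two wells. -/
lemma IsDoubleWell.exists_deriv2_nonneg (hf : IsDoubleWell f) :
    ∃ κ > 0, ∀ s, |s - 1| ≤ κ ∨ |s + 1| ≤ κ → 0 ≤ deriv (deriv f) s := by
  have hc := hf.contDiff_deriv2.continuous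
  obtain ⟨a, ha, h1⟩ := Metric.eventually_nhds_iff.1
    (hc.continuousAt.eventually (lt_mem_nhds hf.deriv2_one))
  obtain ⟨b, hb, h2⟩ := Metric.eventually_nhds_iff.1
    (hc.continuousAt.eventually (lt_mem_nhds hf.deriv2_neg_one))
  refine ⟨min a b / 2, by positivity, fun s hs => ?_⟩
  have hm : 0 < min a b := lt_min ha hb
  rcases hs with hs | hs
  · refine (h1 ?_).le
    rw [Real.dist_eq]; linarith [min_le_left a b]
  · refine (h2 ?_).le
    rw [Real.dist_eq, sub_neg_eq_add]; linarith [min_le_right a b]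

lemma IsOptimalProfile.exists_near_wells (hθ : IsOptimalProfile f θ₀) {κ : ℝ} (hκ : 0 < κ) :
    ∃ R > 0, (∀ ρ, R ≤ ρ → |θ₀ ρ - 1| ≤ κ) ∧ ∀ ρ, ρ ≤ -R → |θ₀ ρ + 1| ≤ κ := by
  obtain ⟨a, ha⟩ := eventually_atTop.1
    (hθ.tendsto_top.eventually (Metric.closedBall_mem_nhds (1 : ℝ) hκ))
  obtain ⟨b, hb⟩ := eventually_atBot.1
    (hθ.tendsto_bot.eventually (Metric.closedBall_mem_nhds (-1 : ℝ) hκ))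
  refine ⟨max 1 (max a (-b)), by positivity, fun ρ hρ => ?_, fun ρ hρ => ?_⟩
  · simpa [Real.dist_eq] using ha ρ (by grind)
  · simpa [Real.dist_eq] using hb ρ (by grind)

lemma IsOptimalProfile.exists_bound (hθ : IsOptimalProfile f θ₀) : ∃ B, ∀ ρ, |θ₀ ρ| ≤ B := by
  obtain ⟨R, hR, h1, h2⟩ := hθ.exists_near_wells one_pos
  obtain ⟨B, hB⟩ := isCompact_Icc.exists_bound_of_continuousOn
    (hθ.contDiff.continuous.continuousOn (s := Icc (-R) R))
  refine ⟨max B 2, fun ρ => ?_⟩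
  by_cases ha : R ≤ ρ
  · have := h1 ρ ha; grind
  by_cases hb : ρ ≤ -R
  · have := h2 ρ hb; grind
  · exact (hB ρ ⟨by linarith, by linarith⟩).trans (le_max_left _ _)

/-- A cut-off takes its values in `[0,1]`, since it is monotone in `|s|`. -/
lemma IsCutoff.mem_Icc {δ : ℝ} {ζ : ℝ → ℝ} (hδ : 0 < δ) (hζ : IsCutoff δ ζ) (s : ℝ) :
    ζ s ∈ Icc 0 1 := by
  have hd : Differentiable ℝ ζ := hζ.smooth.differentiable (by simp)
  by_cases h1 : |s| ≤ δ
  · simp [hζ.eq_one s h1]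
  by_cases h2 : 2 * δ ≤ |s|
  · simp [hζ.eq_zero s h2]
  push Not at h1 h2
  rcases abs_cases s with ⟨e, hs⟩ | ⟨e, hs⟩
  · rw [e] at h1 h2
    have ha : AntitoneOn ζ (Icc δ (2 * δ)) := by
      refine antitoneOn_of_deriv_nonpos (convex_Icc _ _) hd.continuous.continuousOn
        hd.differentiableOn fun x hx => ?_
      rw [interior_Icc] at hx
      have hx0 : 0 < x := hδ.trans hx.1
      have := (hζ.slope x (by rw [abs_of_pos hx0]; exact hx.1.le)
        (by rw [abs_of_pos hx0]; exact hx.2.le)).1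
      by_contra! h
      nlinarith [mul_pos hx0 h]
    have e1 := hζ.eq_one δ (by rw [abs_of_pos hδ])
    have e0 := hζ.eq_zero (2 * δ) (by rw [abs_of_pos (by positivity)])
    exact ⟨e0 ▸ ha ⟨h1.le, h2.le⟩ ⟨by linarith, le_rfl⟩ h2.le,
      e1 ▸ ha ⟨le_rfl, by linarith⟩ ⟨h1.le, h2.le⟩ h1.le⟩
  · rw [e] at h1 h2
    have ha : MonotoneOn ζ (Icc (-(2 * δ)) (-δ)) := by
      refine monotoneOn_of_deriv_nonneg (convex_Icc _ _) hd.continuous.continuousOn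
        hd.differentiableOn fun x hx => ?_
      rw [interior_Icc] at hx
      have hx0 : x < 0 := by linarith [hx.2]
      have := (hζ.slope x (by rw [abs_of_neg hx0]; linarith [hx.2])
        (by rw [abs_of_neg hx0]; linarith [hx.1])).1
      by_contra! h
      nlinarith [mul_pos_of_neg_of_neg hx0 h]
    have e1 := hζ.eq_one (-δ) (by rw [abs_neg, abs_of_pos hδ])
    have e0 := hζ.eq_zero (-(2 * δ)) (by rw [abs_neg, abs_of_pos (by positivity)])
    exact ⟨e0 ▸ ha ⟨le_rfl, by linarith⟩ ⟨by linarith, by linarith⟩ (by linarith),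
      e1 ▸ ha ⟨by linarith, by linarith⟩ ⟨by linarith, le_rfl⟩ (by linarith)⟩

end Profile

section Space

variable {d : ℕ}

local notation "E" => EuclideanSpace ℝ (Fin d)

/-! ### The square of an `H¹` function -/

section Mollification

open scoped Convolution ENNReal

/-- Translations act continuously on `L²`, so the correlation of two `L²` functions is
continuous. -/
lemma continuous_correlation {a b : E → ℝ} (ha : MemLp a 2 volume) (hb : MemLp b 2 volume) :
    Continuous fun z : E => ∫ x, a x * b (x + z) := by
  let T : E → C(E, E) := fun z => ⟨fun x => x + z, by fun_prop⟩
  have hT : Continuous T := by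
    refine ContinuousMap.continuous_of_continuous_uncurry _ ?_
    simp only [T, Function.uncurry_def, ContinuousMap.coe_mk]
    fun_prop
  have hmp : ∀ z, MeasurePreserving (T z) volume volume := fun z =>
    measurePreserving_add_right volume z
  have hc : Continuous fun z => Lp.compMeasurePreserving (T z) (hmp z) (hb.toLp b) :=
    continuous_const.compMeasurePreservingLp hT hmp (by norm_num)
  have h2 : Continuous fun z =>
      inner ℝ (ha.toLp a) (Lp.compMeasurePreserving (T z) (hmp z) (hb.toLp b)) :=
    continuous_const.inner hc
  refine h2.congr fun z => ?_
  rw [L2.inner_def]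
  refine integral_congr_ae ?_
  filter_upwards [ha.coeFn_toLp, Lp.coeFn_compMeasurePreserving (hb.toLp b) (hmp z),
    (hmp z).quasiMeasurePreserving.ae hb.coeFn_toLp] with x h1 h2 h3
  rw [h1, h2, Function.comp_apply, h3]
  simp [T, mul_comm]

/-- Mollifications converge weakly in `L²`. -/
lemma tendsto_integral_mul_convolution_normed {a b : E → ℝ} (ha : MemLp a 2 volume)
    (hb : MemLp b 2 volume) {φ : ℕ → ContDiffBump (0 : E)}
    (hφ : Tendsto (fun k => (φ k).rOut) atTop (𝓝 0)) :
    Tendsto (fun k => ∫ x, a x * (b ⋆[ContinuousLinearMap.mul ℝ ℝ, volume] (φ k).normed volume) x)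
      atTop (𝓝 (∫ x, a x * b x)) := by
  have h1 := ContDiffBump.convolution_tendsto_right_of_continuous (μ := (volume : Measure E)) hφ
    (continuous_correlation ha hb) (0 : E)
  simp only [add_zero] at h1
  refine h1.congr fun k => ?_
  set r := (φ k).normed (volume : Measure E) with hr
  have hrc : Continuous r := (φ k).continuous_normed
  have hri : Integrable r := hrc.integrable_of_hasCompactSupport (φ k).hasCompactSupport_normed
  have hint : Integrable (fun p : E × E => a p.1 * (r p.2 * b (p.1 - p.2)))
      (volume.prod volume) := by
    have i1 : Integrable (fun p : E × E => a p.1 ^ 2 * r p.2) (volume.prod volume) :=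
      ha.integrable_sq.mul_prod hri
    have i2 : Integrable (fun p : E × E => r p.2 * b (p.1 - p.2) ^ 2) (volume.prod volume) :=
      hri.convolution_integrand (ContinuousLinearMap.mul ℝ ℝ) hb.integrable_sq
    refine (i1.add i2).mono' ?_ (Eventually.of_forall fun p => ?_)
    · refine ha.1.comp_fst.mul ?_
      exact hri.1.convolution_integrand (ContinuousLinearMap.mul ℝ ℝ) hb.1
    · have h0 : 0 ≤ r p.2 := (φ k).nonneg_normed _
      simp only [Pi.add_apply, Real.norm_eq_abs, abs_mul, abs_of_nonneg h0]
      have := two_mul_le_add_sq |a p.1| |b (p.1 - p.2)|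
      rw [sq_abs, sq_abs] at this
      nlinarith [mul_nonneg h0 (mul_nonneg (abs_nonneg (a p.1)) (abs_nonneg (b (p.1 - p.2))))]
  calc (r ⋆[ContinuousLinearMap.lsmul ℝ ℝ, volume] fun z => ∫ x, a x * b (x + z)) 0
      = ∫ y, ∫ x, a x * (r y * b (x - y)) := by
        simp only [convolution_def, ContinuousLinearMap.lsmul_apply, smul_eq_mul, zero_sub]
        refine integral_congr_ae (Eventually.of_forall fun y => ?_)
        simp only [← integral_const_mul, sub_eq_add_neg]
        exact integral_congr_ae (Eventually.of_forall fun x => by ring)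
    _ = ∫ x, ∫ y, a x * (r y * b (x - y)) := (integral_integral_swap hint).symm
    _ = ∫ x, a x * (b ⋆[ContinuousLinearMap.mul ℝ ℝ, volume] r) x := by
        refine integral_congr_ae (Eventually.of_forall fun x => ?_)
        simp only [convolution_eq_swap, ContinuousLinearMap.mul_apply', ← integral_const_mul]
        exact integral_congr_ae (Eventually.of_forall fun y => by ring)

variable {Ω : Set (EuclideanSpace ℝ (Fin d))} {ψ : EuclideanSpace ℝ (Fin d) → ℝ}
  {G : EuclideanSpace ℝ (Fin d) → EuclideanSpace ℝ (Fin d)}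

lemma setIntegral_mul_eq_indicator (hΩ : IsOpen Ω) (u w : E → ℝ) :
    ∫ x in Ω, u x * w x = ∫ x, Ω.indicator u x * w x := by
  rw [← integral_indicator hΩ.measurableSet]
  refine integral_congr_ae (Eventually.of_forall fun x => ?_)
  by_cases hx : x ∈ Ω <;> simp [hx]

/-- The weak derivative of `ψ²` is `2 ψ ∇ψ`. -/
lemma IsH1.integral_sq_mul_fderiv (hΩ : IsOpen Ω) (hψ : IsH1 Ω ψ G) {a : E → ℝ}
    (ha : ContDiff ℝ ∞ a) (hac : HasCompactSupport a) (haΩ : tsupport a ⊆ Ω) (v : E) :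
    ∫ x in Ω, ψ x ^ 2 * fderiv ℝ a x v = -(∫ x in Ω, 2 * (ψ x * (inner ℝ (G x) v * a x))) := by
  set u := Ω.indicator ψ with hu
  set g := Ω.indicator fun x => inner ℝ (G x) v with hg
  have hu2 : MemLp u 2 volume := (memLp_indicator_iff_restrict hΩ.measurableSet).2 hψ.memLp
  have hg2 : MemLp g 2 volume :=
    (memLp_indicator_iff_restrict hΩ.measurableSet).2 (hψ.memLp_grad.inner_const v)
  have huL : LocallyIntegrable u volume := hu2.locallyIntegrable (by norm_num)
  have hgL : LocallyIntegrable g volume := hg2.locallyIntegrable (by norm_num)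
  have weak : ∀ φ : E → ℝ, ContDiff ℝ ∞ φ → HasCompactSupport φ → tsupport φ ⊆ Ω →
      ∫ x, u x * fderiv ℝ φ x v = -∫ x, g x * φ x := fun φ h1 h2 h3 => by
    rw [hu, hg, ← setIntegral_mul_eq_indicator hΩ, ← setIntegral_mul_eq_indicator hΩ]
    exact hψ.weak φ h1 h2 h3 v
  obtain ⟨r, hr0, hr⟩ := hac.isCompact.exists_cthickening_subset_open hΩ haΩ
  let φ : ℕ → ContDiffBump (0 : E) := fun k =>
    ⟨r / (2 * (k + 1)), r / (k + 1), by positivity, by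
      apply div_lt_div_of_pos_left hr0 (by positivity)
      linarith [(Nat.cast_nonneg k : (0 : ℝ) ≤ k)]⟩
  have hφr : ∀ k, (φ k).rOut ≤ r := fun k => by
    refine div_le_self hr0.le ?_
    linarith [(Nat.cast_nonneg k : (0 : ℝ) ≤ k)]
  have hφ : Tendsto (fun k => (φ k).rOut) atTop (𝓝 0) := by
    have := (tendsto_one_div_add_atTop_nhds_zero_nat (𝕜 := ℝ)).const_mul r
    simpa [φ, div_eq_mul_inv] using this
  let m : (E → ℝ) → ℕ → E → ℝ := fun b k =>
    b ⋆[ContinuousLinearMap.mul ℝ ℝ, volume] (φ k).normed volume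
  have hm : ∀ {b : E → ℝ}, LocallyIntegrable b volume → ∀ k, ContDiff ℝ ∞ (m b k) :=
    fun hb k => (φ k).hasCompactSupport_normed.contDiff_convolution_right _ hb
      (φ k).contDiff_normed
  -- on the support of `a`, mollification commutes with the weak derivative
  have hmd : ∀ k, ∀ x ∈ tsupport a, fderiv ℝ (m u k) x v = m g k x := by
    intro k x hx
    set ρ := (φ k).normed (volume : Measure E) with hρ
    have hρs : ContDiff ℝ ∞ ρ := (φ k).contDiff_normed
    have hρc : HasCompactSupport ρ := (φ k).hasCompactSupport_normed
    have e1 : fderiv ℝ (m u k) x v = ∫ t, u t * fderiv ℝ ρ (x - t) v := by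
      rw [(hρc.hasFDerivAt_convolution_right (ContinuousLinearMap.mul ℝ ℝ) huL
        (hρs.of_le (by simp)) x).fderiv,
        convolution_precompR_apply _ huL (hρc.fderiv ℝ) (hρs.continuous_fderiv (by simp))]
      rfl
    have hcd : ContDiff ℝ ∞ fun t => ρ (x - t) := hρs.comp (contDiff_const.sub contDiff_id)
    have hts : tsupport (fun t => ρ (x - t)) ⊆ Metric.closedBall x r := by
      refine closure_minimal (fun t ht => ?_) Metric.isClosed_closedBall
      have : x - t ∈ Function.support ρ := ht
      rw [(φ k).support_normed_eq, mem_ball_zero_iff] at this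
      rw [Metric.mem_closedBall, dist_comm, dist_eq_norm]
      exact this.le.trans (hφr k)
    have e2 := weak (fun t => ρ (x - t)) hcd
      ((isCompact_closedBall x r).of_isClosed_subset (isClosed_tsupport _) hts)
      ((hts.trans (Metric.closedBall_subset_cthickening hx r)).trans hr)
    have e3 : ∀ t, fderiv ℝ (fun t => ρ (x - t)) t v = -fderiv ℝ ρ (x - t) v := fun t => by
      have := ((hρs.differentiable (by simp) (x - t)).hasFDerivAt).comp t
        ((hasFDerivAt_id t).const_sub x)
      rw [show (fun t => ρ (x - t)) = ρ ∘ HSub.hSub x from rfl, this.fderiv]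
      simp
    simp only [e3, mul_neg, integral_neg, neg_inj] at e2
    rw [e1, e2]
    rfl
  have hda : Continuous fun x => fderiv ℝ a x v :=
    (ha.continuous_fderiv (by simp)).clm_apply continuous_const
  have hdac : HasCompactSupport fun x => fderiv ℝ a x v := hac.fderiv_apply ℝ v
  have bdd : ∀ {w b : E → ℝ}, MemLp w 2 volume → Continuous b → HasCompactSupport b →
      MemLp (fun x => w x * b x) 2 volume := fun {w b} hw hb hbc => by
    have : MemLp b ∞ volume := hb.memLp_top_of_hasCompactSupport hbc _
    exact MemLp.mul' (r := 2) this hw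
  have int : ∀ {w b c : E → ℝ}, MemLp w 2 volume → Continuous b → HasCompactSupport b →
      Continuous c → Integrable (fun x => w x * b x * c x) volume := fun {w b c} hw hb hbc hc => by
    have h1 : LocallyIntegrable w volume := hw.locallyIntegrable (by norm_num)
    have := h1.integrable_smul_right_of_hasCompactSupport (hb.mul hc) hbc.mul_right
    simpa [mul_assoc] using this
  -- the weak derivative tested with the mollification of `ψ` times `a`
  have key : ∀ k, (∫ x, (u x * fderiv ℝ a x v) * m u k x) + ∫ x, (u x * a x) * m g k x
      = -∫ x, (g x * a x) * m u k x := by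
    intro k
    have hmc := (hm huL k)
    have w := weak (fun x => a x * m u k x) (ha.mul hmc) hac.mul_right
      ((tsupport_mul_subset_left).trans haΩ)
    rw [← integral_add (int hu2 hda hdac hmc.continuous)
      (int hu2 ha.continuous hac (hm hgL k).continuous)]
    simp only [mul_assoc]
    rw [← w]
    refine integral_congr_ae (Eventually.of_forall fun x => ?_)
    have e : fderiv ℝ (fun x => a x * m u k x) x v =
        a x * fderiv ℝ (m u k) x v + m u k x * fderiv ℝ a x v := by
      rw [fderiv_fun_mul (ha.differentiable (by simp) x) (hmc.differentiable (by simp) x)]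
      simp
    have e' : a x * fderiv ℝ (m u k) x v = a x * m g k x := by
      by_cases hx : x ∈ tsupport a
      · rw [hmd k x hx]
      · simp [image_eq_zero_of_notMem_tsupport hx]
    simp only [e, e']
    ring
  have l1 := tendsto_integral_mul_convolution_normed (bdd hu2 hda hdac) hu2 hφ
  have l2 := tendsto_integral_mul_convolution_normed (bdd hu2 ha.continuous hac) hg2 hφ
  have l3 := tendsto_integral_mul_convolution_normed (bdd hg2 ha.continuous hac) hu2 hφ
  have lim := tendsto_nhds_unique ((l1.add l2).congr key) l3.neg
  have f1 : ∫ x in Ω, ψ x ^ 2 * fderiv ℝ a x v = ∫ x, (u x * fderiv ℝ a x v) * u x := by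
    rw [setIntegral_mul_eq_indicator hΩ]
    refine integral_congr_ae (Eventually.of_forall fun x => ?_)
    by_cases hx : x ∈ Ω <;> simp [hu, hx]; ring
  have f2 : ∫ x in Ω, 2 * (ψ x * (inner ℝ (G x) v * a x)) = 2 * ∫ x, (u x * a x) * g x := by
    rw [integral_const_mul, setIntegral_mul_eq_indicator hΩ]
    congr 1
    refine integral_congr_ae (Eventually.of_forall fun x => ?_)
    by_cases hx : x ∈ Ω <;> simp [hu, hg, hx]; ring
  have f3 : ∫ x, (g x * a x) * u x = ∫ x, (u x * a x) * g x :=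
    integral_congr_ae (Eventually.of_forall fun x => by ring)
  rw [f1, f2]
  linarith

end Mollification

/-! ### The signed distance in the tubular neighbourhood -/

section Tube

/-- An evolving hypersurface which divides `Ω`, with an admissible tube width `δ`. -/
structure IsTubularSetting (Ω : Set (EuclideanSpace ℝ (Fin d))) (T₀ : ℝ)
    (Γ Ωp Ωm : ℝ → Set (EuclideanSpace ℝ (Fin d))) (δ : ℝ) : Prop where
  isOpen : IsOpen Ω
  hypersurface : IsEvolvingHypersurface Ω T₀ Γ
  divided : IsDivided Ω T₀ Γ Ωp Ωm
  width : IsTubeWidth Ω T₀ Γ Ωm δ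

variable {Ω : Set (EuclideanSpace ℝ (Fin d))} {T₀ : ℝ}
  {Γ Ωp Ωm : ℝ → Set (EuclideanSpace ℝ (Fin d))} {δ t : ℝ} {x p : EuclideanSpace ℝ (Fin d)}

lemma abs_sdist (x : E) (t : ℝ) : |sdist Γ Ωm x t| = Metric.infDist x (Γ t) := by
  unfold sdist
  split_ifs <;> simp [abs_of_nonneg Metric.infDist_nonneg]

namespace IsTubularSetting

lemma isCompact (S : IsTubularSetting Ω T₀ Γ Ωp Ωm δ) (ht : t ∈ Icc 0 T₀) :
    IsCompact (Γ t) := by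
  have h : IsCompact (spaceTime Γ T₀ ∩ {q | q.2 = t}) :=
    S.hypersurface.compact.inter_right (isClosed_eq continuous_snd continuous_const)
  convert h.image continuous_fst
  ext x
  constructor
  · exact fun h => ⟨(x, t), ⟨⟨ht, h⟩, rfl⟩, rfl⟩
  · rintro ⟨⟨y, s⟩, ⟨⟨-, hy⟩, rfl⟩, rfl⟩
    exact hy

lemma infDist_eq_zero_iff (S : IsTubularSetting Ω T₀ Γ Ωp Ωm δ) (ht : t ∈ Icc 0 T₀) :
    Metric.infDist x (Γ t) = 0 ↔ x ∈ Γ t :=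
  ((S.isCompact ht).isClosed.mem_iff_infDist_zero (S.hypersurface.nonempty t ht)).symm

lemma isOpen_tube (S : IsTubularSetting Ω T₀ Γ Ωp Ωm δ) (r t : ℝ) : IsOpen (tube Ω Γ r t) :=
  S.isOpen.inter (isOpen_lt (Metric.continuous_infDist_pt _) continuous_const)

/-- Since `∂Ω` is at distance more than `2δ` from `Γ_t`, points closer than that lie in `Ω`. -/
lemma mem_of_infDist_le (S : IsTubularSetting Ω T₀ Γ Ωp Ωm δ) (ht : t ∈ Icc 0 T₀)
    (hx : Metric.infDist x (Γ t) ≤ 2 * δ) : x ∈ Ω := by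
  obtain ⟨p, hp, hd⟩ := (S.isCompact ht).exists_infDist_eq_dist (S.hypersurface.nonempty t ht) x
  by_contra hxΩ
  have hpΩ := S.hypersurface.subset t ht hp
  obtain ⟨q, hq, hqf⟩ : ∃ q ∈ segment ℝ p x, q ∈ frontier Ω := by
    by_contra! h
    have hcl : ∀ q ∈ segment ℝ p x, q ∉ Ω → q ∈ (closure Ω)ᶜ := fun q hq hqΩ hc =>
      h q hq ⟨hc, by rwa [S.isOpen.interior_eq]⟩
    obtain ⟨q, -, hq1, hq2⟩ := (convex_segment p x).isPreconnected Ω (closure Ω)ᶜ S.isOpen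
      isClosed_closure.isOpen_compl (fun q hq => or_iff_not_imp_left.2 (hcl q hq))
      ⟨p, left_mem_segment ℝ p x, hpΩ⟩ ⟨x, right_mem_segment ℝ p x,
        hcl x (right_mem_segment ℝ p x) hxΩ⟩
    exact hq2 (subset_closure hq1)
  have h1 := S.width.far_from_boundary t ht p hp q hqf
  have h2 : q ∈ Metric.closedBall p (dist x p) :=
    (convex_closedBall p (dist x p)).segment_subset
      (Metric.mem_closedBall_self dist_nonneg) (Metric.mem_closedBall.2 le_rfl) hq
  rw [Metric.mem_closedBall, dist_comm] at h2
  linarith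

lemma mem_tube (S : IsTubularSetting Ω T₀ Γ Ωp Ωm δ) (ht : t ∈ Icc 0 T₀)
    (hx : Metric.infDist x (Γ t) ≤ 2 * δ) {r : ℝ} (hr : Metric.infDist x (Γ t) < r) :
    x ∈ tube Ω Γ r t :=
  ⟨S.mem_of_infDist_le ht hx, hr⟩

lemma proj_spec (S : IsTubularSetting Ω T₀ Γ Ωp Ωm δ) (ht : t ∈ Icc 0 T₀) (x : E) :
    proj Γ x t ∈ Γ t ∧ dist x (proj Γ x t) = Metric.infDist x (Γ t) := by
  obtain ⟨p, hp, hd⟩ := (S.isCompact ht).exists_infDist_eq_dist (S.hypersurface.nonempty t ht) x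
  exact Classical.epsilon_spec (p := fun p => p ∈ Γ t ∧ dist x p = Metric.infDist x (Γ t))
    ⟨p, hp, hd.symm⟩

lemma contDiffAt (S : IsTubularSetting Ω T₀ Γ Ωp Ωm δ) (ht : t ∈ Icc 0 T₀)
    (hx : x ∈ tube Ω Γ (3 * δ) t) : ContDiffAt ℝ ∞ (fun y => sdist Γ Ωm y t) x := by
  have h : ContDiffOn ℝ ∞ (fun y : E => sdist Γ Ωm y t) (tube Ω Γ (3 * δ) t) :=
    S.width.smooth.comp (f := fun y : E => (y, t)) (by fun_prop) fun y hy => ⟨ht, hy⟩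
  exact h.contDiffAt ((S.isOpen_tube _ t).mem_nhds hx)

/-- The sign of the signed distance is locally constant away from `Γ_t`. -/
lemma exists_sign (S : IsTubularSetting Ω T₀ Γ Ωp Ωm δ) (ht : t ∈ Icc 0 T₀) (hx : x ∈ Ω)
    (hxΓ : x ∉ Γ t) : ∃ s : ℝ, s ^ 2 = 1 ∧
      ∀ᶠ y in 𝓝 x, sdist Γ Ωm y t = s * Metric.infDist y (Γ t) := by
  have h : x ∈ Ωp t ∪ Ωm t := by rw [S.divided.union t ht]; exact ⟨hx, hxΓ⟩
  rcases h with h | h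
  · refine ⟨1, by norm_num, ?_⟩
    filter_upwards [(S.divided.isOpen_plus t ht).mem_nhds h] with y hy
    simp [sdist, (S.divided.disjoint t ht).notMem_of_mem_left hy]
  · refine ⟨-1, by norm_num, ?_⟩
    filter_upwards [(S.divided.isOpen_minus t ht).mem_nhds h] with y hy
    simp [sdist, hy]

/-- Moving from `x` towards its nearest point `p` decreases the distance at unit speed. -/
lemma infDist_add_smul (hp : p ∈ Γ t) (hd : dist x p = Metric.infDist x (Γ t)) {τ : ℝ}
    (h1 : -1 ≤ τ) (h0 : τ ≤ 0) :
    Metric.infDist (x + τ • (x - p)) (Γ t) = (1 + τ) * Metric.infDist x (Γ t) ∧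
      dist (x + τ • (x - p)) p = (1 + τ) * Metric.infDist x (Γ t) := by
  have e : dist (x + τ • (x - p)) p = (1 + τ) * Metric.infDist x (Γ t) := by
    rw [← hd, dist_eq_norm, dist_eq_norm,
      show x + τ • (x - p) - p = (1 + τ) • (x - p) by module, norm_smul, Real.norm_eq_abs,
      abs_of_nonneg (by linarith)]
  refine ⟨le_antisymm (e ▸ Metric.infDist_le_dist_of_mem hp) ?_, e⟩
  have h2 : Metric.infDist x (Γ t) ≤ Metric.infDist (x + τ • (x - p)) (Γ t) +
    dist x (x + τ • (x - p)) := Metric.infDist_le_infDist_add_dist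
  have h3 : dist x (x + τ • (x - p)) = -τ * Metric.infDist x (Γ t) := by
    rw [← hd, dist_eq_norm, dist_eq_norm, show x - (x + τ • (x - p)) = (-τ) • (x - p) by module,
      norm_smul, Real.norm_eq_abs, abs_of_nonneg (by linarith)]
  linarith

/-- Off `Γ_t` the gradient of the signed distance points along the segment to the nearest
point: it has norm at most one, while the distance decreases at unit speed on that segment. -/
lemma gradient_of_notMem (S : IsTubularSetting Ω T₀ Γ Ωp Ωm δ) (ht : t ∈ Icc 0 T₀)
    (hx : x ∈ tube Ω Γ (3 * δ) t) (hxΓ : x ∉ Γ t) (hp : p ∈ Γ t)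
    (hd : dist x p = Metric.infDist x (Γ t)) :
    ∃ s : ℝ, s ^ 2 = 1 ∧ sdist Γ Ωm x t = s * Metric.infDist x (Γ t) ∧
      gradient (fun y => sdist Γ Ωm y t) x = (s / Metric.infDist x (Γ t)) • (x - p) := by
  obtain ⟨s, hs, hsx⟩ := S.exists_sign ht hx.1 hxΓ
  refine ⟨s, hs, hsx.self_of_nhds, ?_⟩
  set r := Metric.infDist x (Γ t) with hr
  set D := fun y => sdist Γ Ωm y t with hD
  have hr0 : 0 < r :=
    lt_of_le_of_ne Metric.infDist_nonneg fun h => hxΓ ((S.infDist_eq_zero_iff ht).1 h.symm)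
  have hdiff : DifferentiableAt ℝ D x := (S.contDiffAt ht hx).differentiableAt (by simp)
  set N := gradient D x with hN
  have hgrad : HasFDerivAt D (InnerProductSpace.toDual ℝ E N) x := hdiff.hasGradientAt.hasFDerivAt
  have hsa : |s| = 1 := by
    rw [← sq_eq_sq₀ (abs_nonneg s) zero_le_one, sq_abs, hs]; norm_num
  have hN1 : ‖N‖ ≤ 1 := by
    have := hgrad.le_of_lip' (C := 1) zero_le_one (by
      filter_upwards [hsx] with y hy
      change ‖sdist Γ Ωm y t - sdist Γ Ωm x t‖ ≤ _
      rw [hy, hsx.self_of_nhds, ← mul_sub, norm_mul, Real.norm_eq_abs, hsa, one_mul, one_mul,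
        ← dist_eq_norm, ← dist_eq_norm]
      simpa using (Metric.lipschitz_infDist_pt (Γ t)).dist_le_mul y x)
    simpa using this
  have hinner : inner ℝ N (x - p) = s * r := by
    have h1 : HasDerivAt (fun τ : ℝ => D (x + τ • (x - p))) (inner ℝ N (x - p)) 0 := by
      have l : HasDerivAt (fun τ : ℝ => x + τ • (x - p)) (x - p) 0 := by
        simpa using ((hasDerivAt_id (0 : ℝ)).smul_const (x - p)).const_add x
      have hg : HasFDerivAt D (InnerProductSpace.toDual ℝ E N) (x + (0 : ℝ) • (x - p)) := by
        simpa using hgrad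
      exact hg.comp_hasDerivAt (0 : ℝ) l
    have h2 : HasDerivAt (fun τ : ℝ => s * ((1 + τ) * r)) (s * r) 0 := by
      simpa using (((hasDerivAt_id (0 : ℝ)).const_add 1).mul_const r).const_mul s
    have hcont : Tendsto (fun τ : ℝ => x + τ • (x - p)) (𝓝 0) (𝓝 x) := by
      have : Continuous fun τ : ℝ => x + τ • (x - p) := by fun_prop
      simpa using this.tendsto 0
    have heq : (fun τ : ℝ => D (x + τ • (x - p))) =ᶠ[𝓝[≤] 0] fun τ => s * ((1 + τ) * r) := by
      have i1 : ∀ᶠ τ : ℝ in 𝓝[≤] 0, -1 ≤ τ :=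
        nhdsWithin_le_nhds (Ici_mem_nhds (by norm_num))
      filter_upwards [nhdsWithin_le_nhds (hcont.eventually hsx), i1, self_mem_nhdsWithin]
        with τ h3 h4 h5
      rw [hD]
      simp only
      rw [h3, (infDist_add_smul hp hd h4 h5).1]
    have h3 := h2.hasDerivWithinAt (s := Iic 0) |>.congr_of_eventuallyEq heq (by
      simp only [zero_smul, add_zero, one_mul]; exact hsx.self_of_nhds)
    exact (uniqueDiffWithinAt_Iic (0 : ℝ)).eq_deriv _ h1.hasDerivWithinAt h3
  have hnorm : ‖x - p‖ = r := by rw [← dist_eq_norm, hd]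
  -- equality in the Cauchy–Schwarz inequality determines the gradient
  rw [← sub_eq_zero, ← norm_eq_zero, ← sq_eq_zero_iff]
  refine le_antisymm ?_ (sq_nonneg _)
  rw [norm_sub_sq_real, inner_smul_right, hinner, norm_smul, hnorm, Real.norm_eq_abs, abs_div,
    hsa, abs_of_pos hr0]
  have e1 : s / r * (s * r) = 1 := by field_simp; exact hs
  have e2 : 1 / r * r = 1 := by field_simp
  rw [e1, e2]
  nlinarith [norm_nonneg N]

lemma continuousAt_gradient (S : IsTubularSetting Ω T₀ Γ Ωp Ωm δ) (ht : t ∈ Icc 0 T₀)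
    (hx : x ∈ tube Ω Γ (3 * δ) t) : ContinuousAt (gradient fun y => sdist Γ Ωm y t) x := by
  have h := ((S.contDiffAt ht hx).fderiv_right (m := ∞) (by simp)).continuousAt
  exact (InnerProductSpace.toDual ℝ E).symm.continuous.continuousAt.comp h

/-- The eikonal equation `|∇ d_Γ| = 1`. -/
lemma norm_gradient (S : IsTubularSetting Ω T₀ Γ Ωp Ωm δ) (ht : t ∈ Icc 0 T₀)
    (hx : x ∈ tube Ω Γ (3 * δ) t) : ‖gradient (fun y => sdist Γ Ωm y t) x‖ = 1 := by
  have off : ∀ y ∈ tube Ω Γ (3 * δ) t, y ∉ Γ t →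
      ‖gradient (fun y => sdist Γ Ωm y t) y‖ = 1 := by
    intro y hy hyΓ
    obtain ⟨hp, hd⟩ := S.proj_spec ht y
    obtain ⟨s, hs, -, e⟩ := S.gradient_of_notMem ht hy hyΓ hp hd
    have hr0 : 0 < Metric.infDist y (Γ t) :=
      lt_of_le_of_ne Metric.infDist_nonneg fun h => hyΓ ((S.infDist_eq_zero_iff ht).1 h.symm)
    have hsa : |s| = 1 := by
      rw [← sq_eq_sq₀ (abs_nonneg s) zero_le_one, sq_abs, hs]; norm_num
    rw [e, norm_smul, ← dist_eq_norm, hd, Real.norm_eq_abs, abs_div, hsa, abs_of_pos hr0]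
    field_simp
  -- points of `Γ_t` are limits of points of `Ω⁺(t)`
  by_cases hxΓ : x ∈ Γ t
  · have hcl : x ∈ closure (Ωp t) := by
      have : x ∈ frontier (Ωp t) ∩ Ω := by rw [S.divided.frontier_plus t ht]; exact hxΓ
      exact frontier_subset_closure this.1
    have hfr : ∃ᶠ y in 𝓝 x, ‖gradient (fun y => sdist Γ Ωm y t) y‖ ∈ ({1} : Set ℝ) := by
      refine ((mem_closure_iff_frequently.1 hcl).and_eventually
        ((S.isOpen_tube (3 * δ) t).mem_nhds hx)).mono fun y hy => off y hy.2 fun hyΓ => ?_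
      have : y ∈ Ω \ Γ t := by rw [← S.divided.union t ht]; exact Or.inl hy.1
      exact this.2 hyΓ
    exact isClosed_singleton.mem_of_frequently_of_tendsto hfr (S.continuousAt_gradient ht hx).norm
  · exact off x hx hxΓ

/-- The nearest point is `P(x) = x - d_Γ(x) ∇ d_Γ(x)`. -/
lemma proj_eq_sub (S : IsTubularSetting Ω T₀ Γ Ωp Ωm δ) (ht : t ∈ Icc 0 T₀)
    (hx : x ∈ tube Ω Γ (3 * δ) t) :
    proj Γ x t = x - sdist Γ Ωm x t • gradient (fun y => sdist Γ Ωm y t) x := by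
  obtain ⟨hp, hd⟩ := S.proj_spec ht x
  by_cases hxΓ : x ∈ Γ t
  · have h0 := (S.infDist_eq_zero_iff ht).2 hxΓ
    have h1 : sdist Γ Ωm x t = 0 := by rw [← abs_eq_zero, abs_sdist, h0]
    rw [h1, zero_smul, sub_zero]
    rw [h0, dist_eq_zero] at hd
    exact hd.symm
  · obtain ⟨s, hs, e1, e2⟩ := S.gradient_of_notMem ht hx hxΓ hp hd
    have hr0 : Metric.infDist x (Γ t) ≠ 0 := fun h => hxΓ ((S.infDist_eq_zero_iff ht).1 h)
    rw [e1, e2, smul_smul, show s * Metric.infDist x (Γ t) * (s / Metric.infDist x (Γ t)) = 1 by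
      field_simp; exact hs, one_smul, sub_sub_cancel]

/-- Up to a sign, which is irrelevant for the projection `I - n ⊗ n`, the normal at the nearest
point is the gradient of the signed distance. -/
lemma normal_proj (S : IsTubularSetting Ω T₀ Γ Ωp Ωm δ) (ht : t ∈ Icc 0 T₀)
    (hx : Metric.infDist x (Γ t) ≤ 2 * δ) :
    normal Γ Ωm (proj Γ x t) t = gradient (fun y => sdist Γ Ωm y t) x ∨
      normal Γ Ωm (proj Γ x t) t = -gradient (fun y => sdist Γ Ωm y t) x := by
  have hδ := S.width.pos
  have hxt : x ∈ tube Ω Γ (3 * δ) t := S.mem_tube ht hx (by linarith)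
  obtain ⟨hp, hd⟩ := S.proj_spec ht x
  set p := proj Γ x t with hpdef
  by_cases hxΓ : x ∈ Γ t
  · have h0 := (S.infDist_eq_zero_iff ht).2 hxΓ
    rw [h0, dist_eq_zero] at hd
    exact Or.inl (by rw [← hd]; rfl)
  set r := Metric.infDist x (Γ t) with hr
  have hr0 : 0 < r :=
    lt_of_le_of_ne Metric.infDist_nonneg fun h => hxΓ ((S.infDist_eq_zero_iff ht).1 h.symm)
  have sgn : ∀ s : ℝ, s ^ 2 = 1 → s = 1 ∨ s = -1 := fun s hs => sq_eq_one_iff.1 hs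
  have hpt : p ∈ tube Ω Γ (3 * δ) t := by
    have := (S.infDist_eq_zero_iff ht).2 hp
    exact S.mem_tube ht (by linarith) (by linarith)
  have hmem : ∀ᶠ τ : ℝ in 𝓝[>] (-1), gradient (fun y => sdist Γ Ωm y t) (x + τ • (x - p)) ∈
      ({(1 / r) • (x - p), -((1 / r) • (x - p))} : Set E) := by
    filter_upwards [self_mem_nhdsWithin,
      nhdsWithin_le_nhds (Iic_mem_nhds (by norm_num : (-1 : ℝ) < 0))] with τ h1 h0
    rw [mem_Ioi] at h1
    rw [mem_Iic] at h0
    obtain ⟨i1, i2⟩ := infDist_add_smul hp hd h1.le h0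
    rw [← hr] at i1 i2
    have i3 : 0 < (1 + τ) * r := mul_pos (by linarith) hr0
    have i4 : (1 + τ) * r ≤ r := by nlinarith
    obtain ⟨s, hs, -, e⟩ := S.gradient_of_notMem (x := x + τ • (x - p)) (p := p) ht
      (S.mem_tube ht (by linarith) (by linarith))
      (fun h => i3.ne' (by rw [← i1]; exact (S.infDist_eq_zero_iff ht).2 h)) hp (by rw [i1, i2])
    rw [e, i1, show x + τ • (x - p) - p = (1 + τ) • (x - p) by module, smul_smul,
      show s / ((1 + τ) * r) * (1 + τ) = s * (1 / r) by
        have : 1 + τ ≠ 0 := by linarith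
        field_simp]
    rcases sgn s hs with rfl | rfl
    · left; simp
    · right; simp
  -- on the open segment the gradient is one of two vectors, so by continuity it is at `p`
  have hlim : Tendsto (fun τ : ℝ => gradient (fun y => sdist Γ Ωm y t) (x + τ • (x - p)))
      (𝓝[>] (-1)) (𝓝 (gradient (fun y => sdist Γ Ωm y t) p)) := by
    have hc : Continuous fun τ : ℝ => x + τ • (x - p) := by fun_prop
    have h1 : Tendsto (fun τ : ℝ => x + τ • (x - p)) (𝓝[>] (-1)) (𝓝 p) := by
      have := (hc.tendsto (-1)).mono_left (nhdsWithin_le_nhds (s := Ioi (-1)))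
      simpa using this
    exact (S.continuousAt_gradient ht hpt).tendsto.comp h1
  have hfin : IsClosed ({(1 / r) • (x - p), -((1 / r) • (x - p))} : Set E) :=
    (Set.toFinite _).isClosed
  have hres := hfin.mem_of_tendsto hlim hmem
  obtain ⟨s, hs, -, e⟩ := S.gradient_of_notMem ht hxt hxΓ hp hd
  rw [e]
  rcases sgn s hs with rfl | rfl
  · exact hres
  · rcases hres with h | h
    · right; rw [normal, h, ← hr, neg_div, neg_smul, neg_neg]
    · left; rw [normal, h, ← hr, neg_div, neg_smul]

/-- Differentiating the eikonal equation: the Hessian of `d_Γ` annihilates `∇ d_Γ`. -/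
lemma fderiv_gradient_apply (S : IsTubularSetting Ω T₀ Γ Ωp Ωm δ) (ht : t ∈ Icc 0 T₀)
    (hx : x ∈ tube Ω Γ (3 * δ) t) :
    fderiv ℝ (gradient fun y => sdist Γ Ωm y t) x (gradient (fun y => sdist Γ Ωm y t) x) = 0 := by
  set D := fun y => sdist Γ Ωm y t with hD
  set N := gradient D with hN
  have hfd : DifferentiableAt ℝ (fderiv ℝ D) x :=
    ((S.contDiffAt ht hx).fderiv_right (m := ∞) (by simp)).differentiableAt (by simp)
  have hNd : HasFDerivAt N (fderiv ℝ N x) x := by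
    refine DifferentiableAt.hasFDerivAt ?_
    exact (InnerProductSpace.toDual ℝ E).symm.differentiable.differentiableAt.comp x hfd
  have hsecond : ∀ u v, inner ℝ (fderiv ℝ N x u) v = fderiv ℝ (fderiv ℝ D) x u v := by
    intro u v
    have h1 : HasFDerivAt (fun y => inner ℝ (N y) v) _ x :=
      hNd.inner ℝ (hasFDerivAt_const v x)
    have h2 : (fun y => inner ℝ (N y) v) = fun y => fderiv ℝ D y v := by
      ext y
      exact inner_gradient_left
    rw [h2] at h1
    have h3 := h1.unique (hfd.hasFDerivAt.clm_apply (hasFDerivAt_const v x))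
    have := congrArg (fun L => L u) h3
    simpa using this
  have hzero : ∀ u, inner ℝ (fderiv ℝ N x u) (N x) = 0 := by
    intro u
    have h1 := hNd.norm_sq
    have h2 : (fun y => ‖N y‖ ^ 2) =ᶠ[𝓝 x] fun _ => (1 : ℝ) := by
      filter_upwards [(S.isOpen_tube (3 * δ) t).mem_nhds hx] with y hy
      rw [S.norm_gradient ht hy, one_pow]
    have h3 := h1.unique ((hasFDerivAt_const (1 : ℝ) x).congr_of_eventuallyEq h2)
    have := congrArg (fun L => L u) h3
    simp at this
    rw [real_inner_comm]
    exact this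
  have hsym : IsSymmSndFDerivAt ℝ D x :=
    (S.contDiffAt ht hx).isSymmSndFDerivAt
      (by rw [minSmoothness_of_isRCLikeNormedField]; exact WithTop.coe_le_coe.2 (le_top (a := (2 : ℕ∞))))
  refine ext_inner_right ℝ fun v => ?_
  rw [hsecond, hsym, ← hsecond, hzero, inner_zero_left]

end IsTubularSetting

end Tube

/-! ### Uniform bounds on the curvature -/

section Curvature

/-- Partial differentiation in `x` preserves smoothness in `(x, t)` on a set which need not be
open in `(x, t)`, nor have unique derivatives, as long as its slices at fixed `t` are open. -/
lemma contDiffOn_fderiv_slice {S : Set (E × ℝ)} (hS : ∀ t, IsOpen {x : E | (x, t) ∈ S})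
    {F : E × ℝ → ℝ} (hF : ContDiffOn ℝ ∞ F S) (v : E) :
    ContDiffOn ℝ ∞ (fun q => fderiv ℝ (fun x => F (x, q.2)) q.1 v) S := by
  refine contDiffOn_infty.2 fun n q hq => ?_
  have h1 : ContDiffWithinAt ℝ ((n : WithTop ℕ∞) + 1) F S q :=
    (hF q hq).of_le (by exact_mod_cast le_top)
  obtain ⟨u, hu, huS, -, F', hF', hF'c⟩ :=
    (contDiffWithinAt_succ_iff_hasFDerivWithinAt' (by simp)).1 h1
  rw [insert_eq_of_mem hq] at hu huS
  have h2 : ContDiffWithinAt ℝ n (fun q => F' q (v, (0 : ℝ))) S q :=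
    hF'c.clm_apply contDiffWithinAt_const
  refine h2.congr_of_eventuallyEq_of_mem ?_ hq
  filter_upwards [hu] with y hy
  have l : HasFDerivAt (fun x : E => (x, y.2)) (ContinuousLinearMap.inl ℝ E ℝ) y.1 :=
    hasFDerivAt_prodMk_left y.1 y.2
  have h3 : HasFDerivWithinAt (fun x : E => F (x, y.2))
      (F' y ∘L ContinuousLinearMap.inl ℝ E ℝ) {x | (x, y.2) ∈ S} y.1 :=
    (hF' y hy).comp y.1 l.hasFDerivWithinAt fun x hx => hx
  have h4 := h3.hasFDerivAt ((hS y.2).mem_nhds (huS hy))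
  rw [h4.fderiv]
  simp

/-- The standard basis vectors. -/
noncomputable def basisVec (i : Fin d) : EuclideanSpace ℝ (Fin d) :=
  EuclideanSpace.basisFun (Fin d) ℝ i

lemma sum_inner_basisVec_smul (w : E) : ∑ i, inner ℝ w (basisVec i) • basisVec i = w := by
  refine (Finset.sum_congr rfl fun i _ => ?_).trans
    ((EuclideanSpace.basisFun (Fin d) ℝ).sum_repr' w)
  rw [real_inner_comm]
  rfl

/-- The Laplacian `Δ d_Γ` of the signed distance; on `Γ_t` it is, up to sign, the sum of the
principal curvatures. -/
noncomputable def lapSdist (Γ Ωm : ℝ → Set (EuclideanSpace ℝ (Fin d)))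
    (x : EuclideanSpace ℝ (Fin d)) (t : ℝ) : ℝ :=
  ∑ i, fderiv ℝ (fun y => fderiv ℝ (fun z => sdist Γ Ωm z t) y (basisVec i)) x (basisVec i)

variable {Ω : Set (EuclideanSpace ℝ (Fin d))} {T₀ : ℝ}
  {Γ Ωp Ωm : ℝ → Set (EuclideanSpace ℝ (Fin d))} {δ t : ℝ} {x : EuclideanSpace ℝ (Fin d)}

namespace IsTubularSetting

lemma isOpen_slice (S : IsTubularSetting Ω T₀ Γ Ωp Ωm δ) (r t : ℝ) :
    IsOpen {x : E | (x, t) ∈ {q : E × ℝ | q.2 ∈ Icc 0 T₀ ∧ q.1 ∈ tube Ω Γ r q.2}} := by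
  by_cases ht : t ∈ Icc 0 T₀
  · have : {x : E | (x, t) ∈ {q : E × ℝ | q.2 ∈ Icc 0 T₀ ∧ q.1 ∈ tube Ω Γ r q.2}}
        = tube Ω Γ r t := by
      ext x; exact ⟨fun h => h.2, fun h => ⟨ht, h⟩⟩
    rw [this]
    exact S.isOpen_tube r t
  · have : {x : E | (x, t) ∈ {q : E × ℝ | q.2 ∈ Icc 0 T₀ ∧ q.1 ∈ tube Ω Γ r q.2}} = ∅ := by
      ext x; exact ⟨fun h => (ht h.1).elim, fun h => h.elim⟩
    rw [this]
    exact isOpen_empty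

lemma contDiffOn_lapSdist (S : IsTubularSetting Ω T₀ Γ Ωp Ωm δ) :
    ContDiffOn ℝ ∞ (fun q : E × ℝ => lapSdist Γ Ωm q.1 q.2)
      {q | q.2 ∈ Icc 0 T₀ ∧ q.1 ∈ tube Ω Γ (3 * δ) q.2} := by
  unfold lapSdist
  exact ContDiffOn.sum fun i _ => contDiffOn_fderiv_slice (S.isOpen_slice (3 * δ))
    (contDiffOn_fderiv_slice (S.isOpen_slice (3 * δ)) S.width.smooth (basisVec i)) (basisVec i)

lemma contDiffAt_lapSdist (S : IsTubularSetting Ω T₀ Γ Ωp Ωm δ) (ht : t ∈ Icc 0 T₀)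
    (hx : x ∈ tube Ω Γ (3 * δ) t) : ContDiffAt ℝ ∞ (fun y => lapSdist Γ Ωm y t) x := by
  have h : ContDiffOn ℝ ∞ (fun y : E => lapSdist Γ Ωm y t) (tube Ω Γ (3 * δ) t) :=
    S.contDiffOn_lapSdist.comp (f := fun y : E => (y, t)) (by fun_prop) fun y hy => ⟨ht, hy⟩
  exact h.contDiffAt ((S.isOpen_tube _ t).mem_nhds hx)

/-- The space-time tube is the image of `Γ` times a closed ball under addition. -/
lemma isCompact_spaceTime_tube (S : IsTubularSetting Ω T₀ Γ Ωp Ωm δ) :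
    IsCompact {q : E × ℝ | q.2 ∈ Icc 0 T₀ ∧ Metric.infDist q.1 (Γ q.2) ≤ δ} := by
  have h := (S.hypersurface.compact.prod (isCompact_closedBall (0 : E) δ)).image
    (f := fun z : (E × ℝ) × E => (z.1.1 + z.2, z.1.2)) (by fun_prop)
  convert h
  ext ⟨x, t⟩
  constructor
  · rintro ⟨ht, hx⟩
    obtain ⟨hp, hd⟩ := S.proj_spec ht x
    refine ⟨((proj Γ x t, t), x - proj Γ x t), ⟨⟨ht, hp⟩, ?_⟩, by simp⟩
    rw [mem_closedBall_zero_iff, ← dist_eq_norm, hd]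
    exact hx
  · rintro ⟨⟨⟨p, s⟩, v⟩, ⟨⟨hs, hp⟩, hv⟩, he⟩
    obtain ⟨rfl, rfl⟩ := Prod.mk.inj he
    refine ⟨hs, (Metric.infDist_le_dist_of_mem hp).trans ?_⟩
    simpa using hv

/-- The normal derivative of `Δ d_Γ` is bounded on the closed tubes, uniformly in time. -/
lemma exists_bound_fderiv_lapSdist (S : IsTubularSetting Ω T₀ Γ Ωp Ωm δ) :
    ∃ C, 0 ≤ C ∧ ∀ t ∈ Icc 0 T₀, ∀ x, Metric.infDist x (Γ t) ≤ δ →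
      |fderiv ℝ (fun y => lapSdist Γ Ωm y t) x (gradient (fun y => sdist Γ Ωm y t) x)| ≤ C := by
  have hδ := S.width.pos
  have hsub : {q : E × ℝ | q.2 ∈ Icc 0 T₀ ∧ Metric.infDist q.1 (Γ q.2) ≤ δ} ⊆
      {q | q.2 ∈ Icc 0 T₀ ∧ q.1 ∈ tube Ω Γ (3 * δ) q.2} := fun q hq =>
    ⟨hq.1, S.mem_tube hq.1 (hq.2.trans (by linarith)) (hq.2.trans_lt (by linarith))⟩
  have hb : ∀ i : Fin d, ∃ C, ∀ q ∈ {q : E × ℝ | q.2 ∈ Icc 0 T₀ ∧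
      Metric.infDist q.1 (Γ q.2) ≤ δ},
      ‖fderiv ℝ (fun y => lapSdist Γ Ωm y q.2) q.1 (basisVec i)‖ ≤ C := fun i =>
    S.isCompact_spaceTime_tube.exists_bound_of_continuousOn
      ((contDiffOn_fderiv_slice (S.isOpen_slice (3 * δ)) S.contDiffOn_lapSdist
        (basisVec i)).continuousOn.mono hsub)
  choose C hC using hb
  refine ⟨∑ i, |C i|, Finset.sum_nonneg fun i _ => abs_nonneg _, fun t ht x hx => ?_⟩
  set N := gradient (fun y => sdist Γ Ωm y t) x with hN
  have hN1 : ‖N‖ = 1 := S.norm_gradient ht (hsub (show (x, t) ∈ _ from ⟨ht, hx⟩)).2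
  rw [← sum_inner_basisVec_smul N, map_sum]
  refine (Finset.abs_sum_le_sum_abs _ _).trans (Finset.sum_le_sum fun i _ => ?_)
  rw [map_smul, smul_eq_mul, abs_mul]
  have h1 : |inner ℝ N (basisVec i)| ≤ 1 := by
    have := abs_real_inner_le_norm N (basisVec i)
    rw [hN1] at this
    simpa [basisVec] using this
  have h2 := hC i (x, t) ⟨ht, hx⟩
  rw [Real.norm_eq_abs] at h2
  calc _ ≤ 1 * |C i| := mul_le_mul h1 (h2.trans (le_abs_self _)) (abs_nonneg _) zero_le_one
    _ = _ := one_mul _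

lemma contDiffAt_fderiv_apply (S : IsTubularSetting Ω T₀ Γ Ωp Ωm δ) (ht : t ∈ Icc 0 T₀)
    (hx : x ∈ tube Ω Γ (3 * δ) t) (v : E) :
    ContDiffAt ℝ ∞ (fun y => fderiv ℝ (fun z => sdist Γ Ωm z t) y v) x :=
  ((S.contDiffAt ht hx).fderiv_right (m := ∞) (by simp)).clm_apply contDiffAt_const

/-- The divergence of the normal field `g ∇ d_Γ` is `∂ₙ g + g Δ d_Γ`. -/
lemma sum_fderiv_mul (S : IsTubularSetting Ω T₀ Γ Ωp Ωm δ) (ht : t ∈ Icc 0 T₀)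
    (hx : x ∈ tube Ω Γ (3 * δ) t) {g : E → ℝ} (hg : DifferentiableAt ℝ g x) :
    ∑ i, fderiv ℝ (fun y => g y * fderiv ℝ (fun z => sdist Γ Ωm z t) y (basisVec i)) x
        (basisVec i) =
      fderiv ℝ g x (gradient (fun y => sdist Γ Ωm y t) x) + g x * lapSdist Γ Ωm x t := by
  have h1 : ∀ i : Fin d, fderiv ℝ
      (fun y => g y * fderiv ℝ (fun z => sdist Γ Ωm z t) y (basisVec i)) x (basisVec i) =
      g x * fderiv ℝ (fun y => fderiv ℝ (fun z => sdist Γ Ωm z t) y (basisVec i)) x (basisVec i)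
      + inner ℝ (gradient (fun y => sdist Γ Ωm y t) x) (basisVec i) *
        fderiv ℝ g x (basisVec i) := fun i => by
    rw [fderiv_fun_mul hg ((S.contDiffAt_fderiv_apply ht hx _).differentiableAt (by simp)),
      inner_gradient_left]
    simp
  simp_rw [h1, Finset.sum_add_distrib, ← Finset.mul_sum]
  rw [add_comm]
  congr 1
  conv_rhs => rw [← sum_inner_basisVec_smul (gradient (fun y => sdist Γ Ωm y t) x), map_sum]
  simp

/-- A function that is smooth in the tube and vanishes at distance at least `δ` from `Γ_t` is
smooth and compactly supported in `Ω`. -/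
lemma contDiff_of_tube (S : IsTubularSetting Ω T₀ Γ Ωp Ωm δ) (ht : t ∈ Icc 0 T₀) {F : E → ℝ}
    (hF : ∀ x ∈ tube Ω Γ (3 * δ) t, ContDiffAt ℝ ∞ F x)
    (h0 : ∀ x, δ ≤ Metric.infDist x (Γ t) → F x = 0) :
    ContDiff ℝ ∞ F ∧ HasCompactSupport F ∧ tsupport F ⊆ Ω := by
  have hδ := S.width.pos
  have hts : tsupport F ⊆ {x | Metric.infDist x (Γ t) ≤ δ} := by
    refine closure_minimal (fun x hx => ?_)
      (isClosed_le (Metric.continuous_infDist_pt _) continuous_const)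
    by_contra h
    exact hx (h0 x (not_le.1 h).le)
  refine ⟨contDiff_iff_contDiffAt.2 fun x => ?_, ?_, fun x hx =>
    S.mem_of_infDist_le ht ((hts hx).trans (by linarith))⟩
  · by_cases hx : Metric.infDist x (Γ t) ≤ δ
    · exact hF x (S.mem_tube ht (by linarith) (by linarith))
    · have : F =ᶠ[𝓝 x] fun _ => 0 := by
        filter_upwards [(isClosed_tsupport F).isOpen_compl.mem_nhds fun h => hx (hts h)] with y hy
        exact image_eq_zero_of_notMem_tsupport hy
      exact contDiffAt_const.congr_of_eventuallyEq this
  · refine (S.isCompact ht).cthickening (r := δ) |>.of_isClosed_subset (isClosed_tsupport F) ?_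
    intro x hx
    refine Metric.mem_cthickening_of_dist_le x (proj Γ x t) δ _ (S.proj_spec ht x).1 ?_
    rw [(S.proj_spec ht x).2]
    exact hts hx

end IsTubularSetting

end Curvature

/-! ### The calibrating normal field -/

section Field

/-- A smooth function of `s`, equal to `0` for `|s| ≤ δ/2` and to `π/2` for `|s| ≥ δ`. Its squared
cosine is the cut-off `η` in the normal direction; it satisfies `η'² ≤ C η (1 - η)`, which a
general smooth cut-off does not. -/
noncomputable def cutAngle (δ s : ℝ) : ℝ :=
  Real.pi / 2 * Real.smoothTransition (2 * (s / δ) ^ 2 - 1 / 2)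

lemma contDiff_cutAngle (δ : ℝ) : ContDiff ℝ ∞ (cutAngle δ) := by
  refine contDiff_const.mul (Real.smoothTransition.contDiff.comp ?_)
  fun_prop

lemma cutAngle_eq_zero {δ s : ℝ} (hδ : 0 < δ) (hs : |s| ≤ δ / 2) : cutAngle δ s = 0 := by
  have h : (s / δ) ^ 2 ≤ (1 / 2) ^ 2 := by
    rw [sq_le_sq, abs_div, abs_of_pos hδ, abs_of_pos (by norm_num : (0 : ℝ) < 1 / 2),
      div_le_iff₀ hδ]
    linarith
  rw [cutAngle, Real.smoothTransition.zero_of_nonpos (by linarith), mul_zero]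

lemma cutAngle_eq_pi_div_two {δ s : ℝ} (hδ : 0 < δ) (hs : δ ≤ |s|) :
    cutAngle δ s = Real.pi / 2 := by
  have h : (1 : ℝ) ^ 2 ≤ (s / δ) ^ 2 := by
    rw [sq_le_sq, abs_div, abs_of_pos hδ, abs_one, le_div_iff₀ hδ]
    linarith
  rw [cutAngle, Real.smoothTransition.one_of_one_le (by linarith), mul_one]

/-- The stretched variable, with a function `b` defined on the whole space in place of the
height function on `Γ_t`, and with the nearest point written as `x - d_Γ ∇ d_Γ`. -/
noncomputable def smoothStretched (Γ Ωm : ℝ → Set (EuclideanSpace ℝ (Fin d)))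
    (b : EuclideanSpace ℝ (Fin d) → ℝ) (ε t : ℝ) (x : EuclideanSpace ℝ (Fin d)) : ℝ :=
  sdist Γ Ωm x t / ε - b (x - sdist Γ Ωm x t • gradient (fun y => sdist Γ Ωm y t) x)

/-- The normal component `η(d_Γ) (ε⁻¹ (θ₀''/θ₀')(ρ) - Δ d_Γ / 2)` of the calibrating field. -/
noncomputable def fieldWeight (θ₀ : ℝ → ℝ) (Γ Ωm : ℝ → Set (EuclideanSpace ℝ (Fin d))) (δ : ℝ)
    (b : EuclideanSpace ℝ (Fin d) → ℝ) (ε t : ℝ) (x : EuclideanSpace ℝ (Fin d)) : ℝ :=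
  Real.cos (cutAngle δ (sdist Γ Ωm x t)) ^ 2 *
    (ε⁻¹ * logDerivProfile θ₀ (smoothStretched Γ Ωm b ε t x) - lapSdist Γ Ωm x t / 2)

variable {Ω : Set (EuclideanSpace ℝ (Fin d))} {T₀ : ℝ} {f θ₀ : ℝ → ℝ}
  {Γ Ωp Ωm : ℝ → Set (EuclideanSpace ℝ (Fin d))} {δ ε t : ℝ} {x : EuclideanSpace ℝ (Fin d)}
  {b : EuclideanSpace ℝ (Fin d) → ℝ}

namespace IsTubularSetting

lemma contDiffAt_gradient (S : IsTubularSetting Ω T₀ Γ Ωp Ωm δ) (ht : t ∈ Icc 0 T₀)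
    (hx : x ∈ tube Ω Γ (3 * δ) t) :
    ContDiffAt ℝ ∞ (gradient fun y => sdist Γ Ωm y t) x :=
  (InnerProductSpace.toDual ℝ E).symm.contDiff.contDiffAt.comp x
    ((S.contDiffAt ht hx).fderiv_right (m := ∞) (by simp))

/-- The signed distance has slope one in the direction of its gradient. -/
lemma fderiv_sdist_gradient (S : IsTubularSetting Ω T₀ Γ Ωp Ωm δ) (ht : t ∈ Icc 0 T₀)
    (hx : x ∈ tube Ω Γ (3 * δ) t) :
    fderiv ℝ (fun y => sdist Γ Ωm y t) x (gradient (fun y => sdist Γ Ωm y t) x) = 1 := by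
  rw [← inner_gradient_left, real_inner_self_eq_norm_sq, S.norm_gradient ht hx, one_pow]

lemma contDiffAt_smoothStretched (S : IsTubularSetting Ω T₀ Γ Ωp Ωm δ) (ht : t ∈ Icc 0 T₀)
    (hx : x ∈ tube Ω Γ (3 * δ) t) (hb : ContDiff ℝ ∞ b) :
    ContDiffAt ℝ ∞ (smoothStretched Γ Ωm b ε t) x :=
  ((S.contDiffAt ht hx).div_const ε).sub (hb.contDiffAt.comp x
    (contDiffAt_id.sub ((S.contDiffAt ht hx).smul (S.contDiffAt_gradient ht hx))))

/-- The nearest point does not change in the normal direction, so that the normal derivative of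
the stretched variable is `1/ε`. -/
lemma fderiv_smoothStretched (S : IsTubularSetting Ω T₀ Γ Ωp Ωm δ) (ht : t ∈ Icc 0 T₀)
    (hx : x ∈ tube Ω Γ (3 * δ) t) (hb : ContDiff ℝ ∞ b) :
    fderiv ℝ (smoothStretched Γ Ωm b ε t) x (gradient (fun y => sdist Γ Ωm y t) x) = ε⁻¹ := by
  have hD := ((S.contDiffAt ht hx).differentiableAt (by simp)).hasFDerivAt
  have hN := ((S.contDiffAt_gradient ht hx).differentiableAt (by simp)).hasFDerivAt
  have hP := (hasFDerivAt_id x).sub (hD.smul hN)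
  have hB := (hb.differentiable (by simp) _).hasFDerivAt.comp x hP
  have hDε : HasFDerivAt (fun y => sdist Γ Ωm y t / ε)
      (ε⁻¹ • fderiv ℝ (fun y => sdist Γ Ωm y t) x) x := by
    simpa only [div_eq_mul_inv] using hD.mul_const ε⁻¹
  have h := hDε.sub hB
  have e : smoothStretched Γ Ωm b ε t = (fun y => sdist Γ Ωm y t / ε) - b ∘ (id -
      (fun y => sdist Γ Ωm y t) • (gradient fun y => sdist Γ Ωm y t)) := rfl
  rw [e, h.fderiv]
  simp [S.fderiv_sdist_gradient ht hx, S.fderiv_gradient_apply ht hx]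

lemma contDiffAt_fieldWeight (S : IsTubularSetting Ω T₀ Γ Ωp Ωm δ) (ht : t ∈ Icc 0 T₀)
    (hf : IsDoubleWell f) (hθ : IsOptimalProfile f θ₀)
    (hx : x ∈ tube Ω Γ (3 * δ) t) (hb : ContDiff ℝ ∞ b) :
    ContDiffAt ℝ ∞ (fieldWeight θ₀ Γ Ωm δ b ε t) x := by
  refine ContDiffAt.mul (ContDiffAt.pow ?_ 2) (ContDiffAt.sub (contDiffAt_const.mul ?_)
    ((S.contDiffAt_lapSdist ht hx).div_const 2))
  · exact Real.contDiff_cos.contDiffAt.comp x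
      ((contDiff_cutAngle δ).contDiffAt.comp x (S.contDiffAt ht hx))
  · exact (hθ.contDiff_logDerivProfile hf).contDiffAt.comp x
      (S.contDiffAt_smoothStretched ht hx hb)

lemma fieldWeight_eq_zero (S : IsTubularSetting Ω T₀ Γ Ωp Ωm δ)
    (hx : δ ≤ Metric.infDist x (Γ t)) : fieldWeight θ₀ Γ Ωm δ b ε t x = 0 := by
  rw [fieldWeight, cutAngle_eq_pi_div_two S.width.pos (by rwa [abs_sdist]), Real.cos_pi_div_two]
  ring

/-- The normal derivative of the field, by the Riccati equation for `θ₀''/θ₀'`. -/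
lemma fderiv_fieldWeight (S : IsTubularSetting Ω T₀ Γ Ωp Ωm δ) (ht : t ∈ Icc 0 T₀)
    (hf : IsDoubleWell f) (hθ : IsOptimalProfile f θ₀)
    (hx : x ∈ tube Ω Γ (3 * δ) t) (hb : ContDiff ℝ ∞ b) :
    fderiv ℝ (fieldWeight θ₀ Γ Ωm δ b ε t) x (gradient (fun y => sdist Γ Ωm y t) x) =
      -2 * Real.cos (cutAngle δ (sdist Γ Ωm x t)) * Real.sin (cutAngle δ (sdist Γ Ωm x t)) *
        deriv (cutAngle δ) (sdist Γ Ωm x t) *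
        (ε⁻¹ * logDerivProfile θ₀ (smoothStretched Γ Ωm b ε t x) - lapSdist Γ Ωm x t / 2) +
      Real.cos (cutAngle δ (sdist Γ Ωm x t)) ^ 2 *
        (ε⁻¹ ^ 2 * deriv (deriv f) (θ₀ (smoothStretched Γ Ωm b ε t x)) -
          (ε⁻¹ * logDerivProfile θ₀ (smoothStretched Γ Ωm b ε t x)) ^ 2 -
          fderiv ℝ (fun y => lapSdist Γ Ωm y t) x (gradient (fun y => sdist Γ Ωm y t) x) / 2)
      := by
  have hD := ((S.contDiffAt ht hx).differentiableAt (by simp)).hasFDerivAt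
  have hL := ((S.contDiffAt_lapSdist ht hx).differentiableAt (by simp)).hasFDerivAt
  have hρ := ((S.contDiffAt_smoothStretched (ε := ε) ht hx hb).differentiableAt
    (by simp)).hasFDerivAt
  have hβ := ((contDiff_cutAngle δ).differentiable (by simp) (sdist Γ Ωm x t)).hasDerivAt
  have h1 := (hβ.comp_hasFDerivAt x hD).cos.pow 2
  have h2 := ((hθ.hasDerivAt_logDerivProfile hf _).comp_hasFDerivAt x hρ).const_mul ε⁻¹
  have h3 : HasFDerivAt (fun y => lapSdist Γ Ωm y t / 2)
      ((2 : ℝ)⁻¹ • fderiv ℝ (fun y => lapSdist Γ Ωm y t) x) x := by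
    simpa only [div_eq_mul_inv] using hL.mul_const (2 : ℝ)⁻¹
  have h := congrArg (fun L => L (gradient (fun y => sdist Γ Ωm y t) x)) (h1.mul (h2.sub h3)).fderiv
  refine Eq.trans (by rfl) (h.trans ?_)
  simp [S.fderiv_sdist_gradient ht hx, S.fderiv_smoothStretched (ε := ε) ht hx hb]
  ring

/-- Completing squares bounds the divergence plus the square of the field by the potential. -/
lemma fderiv_fieldWeight_add_le (S : IsTubularSetting Ω T₀ Γ Ωp Ωm δ) (ht : t ∈ Icc 0 T₀)
    (hf : IsDoubleWell f) (hθ : IsOptimalProfile f θ₀)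
    (hx : x ∈ tube Ω Γ (3 * δ) t) (hb : ContDiff ℝ ∞ b) :
    fderiv ℝ (fieldWeight θ₀ Γ Ωm δ b ε t) x (gradient (fun y => sdist Γ Ωm y t) x) +
      fieldWeight θ₀ Γ Ωm δ b ε t x * lapSdist Γ Ωm x t + fieldWeight θ₀ Γ Ωm δ b ε t x ^ 2 ≤
    Real.cos (cutAngle δ (sdist Γ Ωm x t)) ^ 2 *
        (ε⁻¹ ^ 2 * deriv (deriv f) (θ₀ (smoothStretched Γ Ωm b ε t x))) +
      deriv (cutAngle δ) (sdist Γ Ωm x t) ^ 2 +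
      |fderiv ℝ (fun y => lapSdist Γ Ωm y t) x (gradient (fun y => sdist Γ Ωm y t) x)| := by
  rw [S.fderiv_fieldWeight ht hf hθ hx hb, fieldWeight]
  have hcs := Real.sin_sq_add_cos_sq (cutAngle δ (sdist Γ Ωm x t))
  set c := Real.cos (cutAngle δ (sdist Γ Ωm x t))
  set s := Real.sin (cutAngle δ (sdist Γ Ωm x t))
  set β := deriv (cutAngle δ) (sdist Γ Ωm x t)
  set V := ε⁻¹ ^ 2 * deriv (deriv f) (θ₀ (smoothStretched Γ Ωm b ε t x))
  set q := ε⁻¹ * logDerivProfile θ₀ (smoothStretched Γ Ωm b ε t x)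
  set K := fderiv ℝ (fun y => lapSdist Γ Ωm y t) x (gradient (fun y => sdist Γ Ωm y t) x)
  set L := lapSdist Γ Ωm x t
  have h1 : -2 * c * s * β * (q - L / 2) + c ^ 2 * (V - q ^ 2 - K / 2) + c ^ 2 * (q - L / 2) * L +
      (c ^ 2 * (q - L / 2)) ^ 2 = c ^ 2 * V + β ^ 2 - c ^ 2 * K / 2 -
        (c * s * (q - L / 2) + β) ^ 2 - c ^ 2 * (L / 2) ^ 2 := by
    have : s ^ 2 = 1 - c ^ 2 := by linarith
    linear_combination (c ^ 2 * (q - L / 2) ^ 2) * this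
  have hc1 : c ^ 2 ≤ 1 := by nlinarith [sq_nonneg s]
  have h2 : -(c ^ 2 * K / 2) ≤ |K| := by
    nlinarith [neg_abs_le K, abs_nonneg K, sq_nonneg c,
      mul_le_mul_of_nonneg_left (neg_abs_le K) (sq_nonneg c),
      mul_le_mul_of_nonneg_right hc1 (abs_nonneg K)]
  rw [h1]
  nlinarith [sq_nonneg (c * s * (q - L / 2) + β), sq_nonneg (c * (L / 2))]

end IsTubularSetting

end Field

/-! ### The calibrated energy inequality -/

section Calibration

lemma norm_sub_inner_smul_sq {n v : E} (hn : ‖n‖ = 1) :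
    ‖v - inner ℝ n v • n‖ ^ 2 = ‖v‖ ^ 2 - inner ℝ n v ^ 2 := by
  rw [norm_sub_sq_real, inner_smul_right, norm_smul, hn, real_inner_comm n v, Real.norm_eq_abs,
    mul_one, sq_abs]
  ring

lemma integrable_mul_of_hasCompactSupport {μ : Measure E} {u a : E → ℝ} (hu : Integrable u μ)
    (ha : Continuous a) (hac : HasCompactSupport a) : Integrable (fun x => u x * a x) μ := by
  obtain ⟨C, hC⟩ := ha.bounded_above_of_compact_support hac
  exact hu.mul_bdd ha.aestronglyMeasurable (Eventually.of_forall hC)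

variable {Ω : Set (EuclideanSpace ℝ (Fin d))} {T₀ : ℝ}
  {Γ Ωp Ωm : ℝ → Set (EuclideanSpace ℝ (Fin d))} {δ t : ℝ}
  {ψ : EuclideanSpace ℝ (Fin d) → ℝ} {G : EuclideanSpace ℝ (Fin d) → EuclideanSpace ℝ (Fin d)}

namespace IsTubularSetting

/-- If `div (g n) + g² ≤ W + C` for a normal field `g n` supported in the tube, `n = ∇ d_Γ`, then
the potential `W` can be absorbed by the normal part of the gradient. -/
theorem calibration (S : IsTubularSetting Ω T₀ Γ Ωp Ωm δ) (ht : t ∈ Icc 0 T₀)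
    (hψ : IsH1 Ω ψ G) {g W : E → ℝ} {C : ℝ}
    (hg : ∀ x ∈ tube Ω Γ (3 * δ) t, ContDiffAt ℝ ∞ g x)
    (hg0 : ∀ x, δ ≤ Metric.infDist x (Γ t) → g x = 0)
    (hW : Integrable (fun x => W x * ψ x ^ 2) (volume.restrict Ω))
    (hin : ∀ x, Metric.infDist x (Γ t) ≤ δ →
      fderiv ℝ g x (gradient (fun y => sdist Γ Ωm y t) x) + g x * lapSdist Γ Ωm x t + g x ^ 2
        ≤ W x + C)
    (hout : ∀ x ∈ Ω, δ < Metric.infDist x (Γ t) → 0 ≤ W x + C) :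
    -C * (∫ x in Ω, ψ x ^ 2) + (∫ x in Ω \ tube Ω Γ δ t, ‖G x‖ ^ 2)
        + (∫ x in tube Ω Γ δ t, ‖tangential Γ Ωm x t (G x)‖ ^ 2)
      ≤ ∫ x in Ω, (‖G x‖ ^ 2 + W x * ψ x ^ 2) := by
  have hδ := S.width.pos
  let a : Fin d → E → ℝ := fun i y =>
    g y * fderiv ℝ (fun z => sdist Γ Ωm z t) y (basisVec i)
  obtain ⟨hgs, hgc, -⟩ := S.contDiff_of_tube ht hg hg0
  have ha : ∀ i, ContDiff ℝ ∞ (a i) ∧ HasCompactSupport (a i) ∧ tsupport (a i) ⊆ Ω := fun i =>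
    S.contDiff_of_tube ht (fun x hx => (hg x hx).mul (S.contDiffAt_fderiv_apply ht hx _))
      fun x hx => by simp only [a, hg0 x hx, zero_mul]
  have ha' : ∀ i, Continuous fun x => fderiv ℝ (a i) x (basisVec i) := fun i =>
    ((ha i).1.continuous_fderiv (by simp)).clm_apply continuous_const
  set N := gradient fun y => sdist Γ Ωm y t with hN
  let dv : E → ℝ := fun x => ∑ i, fderiv ℝ (a i) x (basisVec i)
  have hψ2 : Integrable (fun x => ψ x ^ 2) (volume.restrict Ω) := hψ.memLp.integrable_sq
  have hG2 : Integrable (fun x => ‖G x‖ ^ 2) (volume.restrict Ω) :=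
    hψ.memLp_grad.norm.integrable_sq
  have hY : ∀ x, ∑ i, inner ℝ (G x) (basisVec i) * a i x = g x * inner ℝ (N x) (G x) := by
    intro x
    conv_rhs => rw [← sum_inner_basisVec_smul (G x), inner_sum, Finset.mul_sum]
    refine Finset.sum_congr rfl fun i _ => ?_
    rw [inner_smul_right, hN, inner_gradient_left]
    ring
  -- the integrated product rule, summed over the coordinates
  have iψdv : ∀ i, Integrable (fun x => ψ x ^ 2 * fderiv ℝ (a i) x (basisVec i))
      (volume.restrict Ω) := fun i =>
    integrable_mul_of_hasCompactSupport hψ2 (ha' i) ((ha i).2.1.fderiv_apply ℝ _)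
  have iψY : ∀ i, Integrable (fun x => 2 * (ψ x * (inner ℝ (G x) (basisVec i) * a i x)))
      (volume.restrict Ω) := fun i => by
    have h1 : Integrable (fun x => ψ x * inner ℝ (G x) (basisVec i)) (volume.restrict Ω) :=
      hψ.memLp.integrable_mul (hψ.memLp_grad.inner_const (basisVec i))
    have := (integrable_mul_of_hasCompactSupport h1 (ha i).1.continuous (ha i).2.1).const_mul 2
    simpa only [mul_assoc] using this
  have key : ∫ x in Ω, ψ x ^ 2 * dv x = -∫ x in Ω, 2 * (ψ x * (g x * inner ℝ (N x) (G x))) := by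
    simp only [dv, Finset.mul_sum, ← hY]
    rw [integral_finsetSum _ fun i _ => iψdv i, integral_finsetSum _ fun i _ => iψY i,
      ← Finset.sum_neg_distrib]
    exact Finset.sum_congr rfl fun i _ =>
      hψ.integral_sq_mul_fderiv S.isOpen (ha i).1 (ha i).2.1 (ha i).2.2 _
  have iY : Integrable (fun x => 2 * (ψ x * (g x * inner ℝ (N x) (G x))))
      (volume.restrict Ω) := by
    simp only [← hY, Finset.mul_sum]
    exact integrable_finsetSum _ fun i _ => iψY i
  have idv : Integrable (fun x => ψ x ^ 2 * dv x) (volume.restrict Ω) := by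
    simp only [dv, Finset.mul_sum]
    exact integrable_finsetSum _ fun i _ => iψdv i
  have ig : Integrable (fun x => ψ x ^ 2 * g x ^ 2) (volume.restrict Ω) := by
    refine integrable_mul_of_hasCompactSupport hψ2 (hgs.continuous.pow 2) ?_
    simp only [sq]
    exact hgc.mul_left
  have iQ : Integrable (fun x => ‖G x‖ ^ 2 - 2 * (ψ x * (g x * inner ℝ (N x) (G x))) +
      ψ x ^ 2 * g x ^ 2) (volume.restrict Ω) := (hG2.sub iY).add ig
  have hT : MeasurableSet (tube Ω Γ δ t) := (S.isOpen_tube δ t).measurableSet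
  have hTΩ : tube Ω Γ δ t ⊆ Ω := fun x hx => hx.1
  have hD : MeasurableSet (Ω \ tube Ω Γ δ t) := S.isOpen.measurableSet.diff hT
  -- the square `(∂ₙψ - g ψ)² ≥ 0` in the tube
  have q1 : ∫ x in tube Ω Γ δ t, ‖tangential Γ Ωm x t (G x)‖ ^ 2 ≤
      ∫ x in tube Ω Γ δ t, (‖G x‖ ^ 2 - 2 * (ψ x * (g x * inner ℝ (N x) (G x))) +
        ψ x ^ 2 * g x ^ 2) := by
    refine integral_mono_of_nonneg (Eventually.of_forall fun x => sq_nonneg _)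
      (iQ.mono_measure (Measure.restrict_mono hTΩ le_rfl)) ?_
    filter_upwards [ae_restrict_mem hT] with x hx
    have hx2 : Metric.infDist x (Γ t) < δ := hx.2
    have hn : ‖N x‖ = 1 := S.norm_gradient ht ⟨hx.1, hx2.trans (by linarith)⟩
    have e : ‖tangential Γ Ωm x t (G x)‖ ^ 2 = ‖G x‖ ^ 2 - inner ℝ (N x) (G x) ^ 2 := by
      unfold tangential
      rcases S.normal_proj ht (x := x) (by linarith) with h | h
      · rw [h, norm_sub_inner_smul_sq hn]
      · rw [h, norm_sub_inner_smul_sq (by rwa [norm_neg]), inner_neg_left, neg_sq]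
    rw [e]
    nlinarith [sq_nonneg (inner ℝ (N x) (G x) - g x * ψ x)]
  have q2 : ∫ x in Ω \ tube Ω Γ δ t, ‖G x‖ ^ 2 =
      ∫ x in Ω \ tube Ω Γ δ t, (‖G x‖ ^ 2 - 2 * (ψ x * (g x * inner ℝ (N x) (G x))) +
        ψ x ^ 2 * g x ^ 2) := by
    refine setIntegral_congr_fun hD fun x hx => ?_
    have : δ ≤ Metric.infDist x (Γ t) := by
      by_contra! h
      exact hx.2 ⟨hx.1, h⟩
    simp [hg0 x this]
  have q3 : (∫ x in tube Ω Γ δ t, (‖G x‖ ^ 2 - 2 * (ψ x * (g x * inner ℝ (N x) (G x))) +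
        ψ x ^ 2 * g x ^ 2)) + ∫ x in Ω \ tube Ω Γ δ t, (‖G x‖ ^ 2 -
        2 * (ψ x * (g x * inner ℝ (N x) (G x))) + ψ x ^ 2 * g x ^ 2) =
      ∫ x in Ω, (‖G x‖ ^ 2 - 2 * (ψ x * (g x * inner ℝ (N x) (G x))) + ψ x ^ 2 * g x ^ 2) := by
    have := setIntegral_union (disjoint_sdiff_right (s := tube Ω Γ δ t) (t := Ω)) hD
      (IntegrableOn.mono_set iQ hTΩ) (IntegrableOn.mono_set iQ sdiff_subset)
    rw [← this, union_sdiff_cancel hTΩ]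
  have q4 : ∫ x in Ω, (‖G x‖ ^ 2 - 2 * (ψ x * (g x * inner ℝ (N x) (G x))) +
        ψ x ^ 2 * g x ^ 2) = (∫ x in Ω, ‖G x‖ ^ 2) +
        ((∫ x in Ω, ψ x ^ 2 * dv x) + ∫ x in Ω, ψ x ^ 2 * g x ^ 2) := by
    have iGY : Integrable (fun x => ‖G x‖ ^ 2 - 2 * (ψ x * (g x * inner ℝ (N x) (G x))))
        (volume.restrict Ω) := hG2.sub iY
    rw [integral_add iGY ig, integral_sub hG2 iY, key]
    ring
  have q5 : (∫ x in Ω, ψ x ^ 2 * dv x) + ∫ x in Ω, ψ x ^ 2 * g x ^ 2 ≤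
      (∫ x in Ω, W x * ψ x ^ 2) + C * ∫ x in Ω, ψ x ^ 2 := by
    rw [← integral_add idv ig, ← integral_const_mul, ← integral_add hW (hψ2.const_mul C)]
    refine integral_mono_ae (idv.add ig) (hW.add (hψ2.const_mul C)) ?_
    filter_upwards [ae_restrict_mem S.isOpen.measurableSet] with x hxΩ
    suffices h : dv x + g x ^ 2 ≤ W x + C by
      nlinarith [mul_le_mul_of_nonneg_left h (sq_nonneg (ψ x))]
    by_cases hx : Metric.infDist x (Γ t) ≤ δ
    · have hxt : x ∈ tube Ω Γ (3 * δ) t := ⟨hxΩ, by linarith⟩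
      have := S.sum_fderiv_mul ht hxt ((hg x hxt).differentiableAt (by simp))
      rw [show dv x = _ from this]
      exact hin x hx
    · have hx' := not_le.1 hx
      have e : dv x = 0 := by
        refine Finset.sum_eq_zero fun i _ => ?_
        have : a i =ᶠ[𝓝 x] fun _ => 0 := by
          filter_upwards [(isOpen_lt continuous_const
            (Metric.continuous_infDist_pt (Γ t))).mem_nhds hx'] with y hy
          simp only [a, hg0 y (le_of_lt hy), zero_mul]
        rw [this.fderiv_eq]
        simp
      rw [e, hg0 x hx'.le]
      simpa using hout x hxΩ hx'
  rw [integral_add hG2 hW]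
  linarith

end IsTubularSetting

end Calibration

/-! ### The approximate solution -/

section Approximate

/-- A continuous function on a closed set is a uniform limit of smooth functions of the whole
space. -/
lemma exists_contDiff_approx_on {K : Set E} (hK : IsClosed K) {u : E → ℝ}
    (hu : ContinuousOn u K) {η : ℝ} (hη : 0 < η) :
    ∃ b : E → ℝ, ContDiff ℝ ∞ b ∧ ∀ p ∈ K, |b p - u p| < η := by
  obtain ⟨v, hv⟩ := ContinuousMap.exists_restrict_eq hK ⟨K.domRestrict u, hu.domRestrict⟩
  obtain ⟨b, hb, hbv, -⟩ := v.continuous.exists_contDiff_approx (ε := fun _ => η) ⊤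
    continuous_const fun _ => hη
  refine ⟨b, hb, fun p hp => ?_⟩
  have h1 : v p = u p := congrArg (fun w => w ⟨p, hp⟩) hv
  rw [← h1, ← Real.dist_eq]
  exact hbv p

variable {Ω : Set (EuclideanSpace ℝ (Fin d))} {T₀ : ℝ} {f θ₀ ζ : ℝ → ℝ}
  {Γ Ωp Ωm : ℝ → Set (EuclideanSpace ℝ (Fin d))} {δ ε t : ℝ} {x : EuclideanSpace ℝ (Fin d)}
  {h c₂ : EuclideanSpace ℝ (Fin d) → ℝ → ℝ}

namespace IsTubularSetting

lemma measurable_sdist (S : IsTubularSetting Ω T₀ Γ Ωp Ωm δ) (ht : t ∈ Icc 0 T₀) :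
    Measurable fun x : E => sdist Γ Ωm x t := by
  unfold sdist
  exact Measurable.ite (S.divided.isOpen_minus t ht).measurableSet
    (Metric.continuous_infDist_pt _).measurable.neg (Metric.continuous_infDist_pt _).measurable

lemma continuousOn_stretched (S : IsTubularSetting Ω T₀ Γ Ωp Ωm δ) (ht : t ∈ Icc 0 T₀)
    (hh : ContinuousOn (fun q : E × ℝ => h q.1 q.2) (spaceTime Γ T₀)) :
    ContinuousOn (fun x => stretched Γ Ωm h ε x t) (tube Ω Γ (3 * δ) t) := by
  have hD : ContinuousOn (fun x : E => sdist Γ Ωm x t) (tube Ω Γ (3 * δ) t) := fun x hx =>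
    (S.contDiffAt ht hx).continuousAt.continuousWithinAt
  have hP : ContinuousOn (fun x => proj Γ x t) (tube Ω Γ (3 * δ) t) := by
    refine ContinuousOn.congr (f := fun x => x - sdist Γ Ωm x t •
      gradient (fun y => sdist Γ Ωm y t) x) ?_ fun x hx => S.proj_eq_sub ht hx
    exact continuousOn_id.sub (hD.smul fun x hx =>
      (S.continuousAt_gradient ht hx).continuousWithinAt)
  exact (hD.div_const ε).sub (hh.comp (hP.prodMk continuousOn_const)
    fun x _ => ⟨ht, (S.proj_spec ht x).1⟩)

/-- The approximate solution is measurable; the nearest point, which is an arbitrary choice away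
from the tube, enters only where the cut-off does not vanish. -/
lemma aestronglyMeasurable_cA (S : IsTubularSetting Ω T₀ Γ Ωp Ωm δ) (ht : t ∈ Icc 0 T₀)
    (hθ : Continuous θ₀) (hζ : IsCutoff δ ζ)
    (hh : ContinuousOn (fun q : E × ℝ => h q.1 q.2) (spaceTime Γ T₀))
    (hc : AEStronglyMeasurable (fun x => c₂ x t) (volume.restrict Ω)) :
    AEStronglyMeasurable (fun x => cA θ₀ ζ Γ Ωp Ωm h c₂ ε x t) (volume.restrict Ω) := by
  have hδ := S.width.pos
  have hζm : Measurable fun x : E => ζ (sdist Γ Ωm x t) :=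
    hζ.smooth.continuous.measurable.comp (S.measurable_sdist ht)
  have hT : MeasurableSet (tube Ω Γ (3 * δ) t) := (S.isOpen_tube _ t).measurableSet
  have h1 : AEStronglyMeasurable ((tube Ω Γ (3 * δ) t).indicator
      fun x => ζ (sdist Γ Ωm x t) * θ₀ (stretched Γ Ωm h ε x t)) (volume.restrict Ω) := by
    refine AEStronglyMeasurable.mono_measure ?_ Measure.restrict_le_self
    rw [aestronglyMeasurable_indicator_iff hT]
    exact hζm.aestronglyMeasurable.mul
      ((hθ.comp_continuousOn (S.continuousOn_stretched ht hh)).aestronglyMeasurable hT)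
  have h2 : AEStronglyMeasurable (fun x => ζ (sdist Γ Ωm x t) * θ₀ (stretched Γ Ωm h ε x t))
      (volume.restrict Ω) := by
    refine h1.congr ?_
    filter_upwards [ae_restrict_mem S.isOpen.measurableSet] with x hx
    by_cases hxt : x ∈ tube Ω Γ (3 * δ) t
    · rw [indicator_of_mem hxt]
    · rw [indicator_of_notMem hxt, hζ.eq_zero, zero_mul]
      rw [abs_sdist]
      by_contra! hlt
      exact hxt ⟨hx, by linarith⟩
  have h3 : Measurable fun x : E => (1 - ζ (sdist Γ Ωm x t)) *
      ((Ωp t).indicator (fun _ => (1 : ℝ)) x - (Ωm t).indicator (fun _ => (1 : ℝ)) x) :=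
    (measurable_const.sub hζm).mul
      ((measurable_const.indicator (S.divided.isOpen_plus t ht).measurableSet).sub
        (measurable_const.indicator (S.divided.isOpen_minus t ht).measurableSet))
  exact (h2.add h3.aestronglyMeasurable).add (hc.const_mul (ε ^ 2))

/-- Inside the tube the approximate solution is the rescaled profile, up to `O(ε²)`. -/
lemma cA_of_infDist_le (hζ : IsCutoff δ ζ) (hx : Metric.infDist x (Γ t) ≤ δ) :
    cA θ₀ ζ Γ Ωp Ωm h c₂ ε x t = θ₀ (stretched Γ Ωm h ε x t) + ε ^ 2 * c₂ x t := by
  rw [cA, cA₀, hζ.eq_one _ (by rwa [abs_sdist])]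
  ring

/-- Outside the tube the approximate solution is close to one of the wells. -/
lemma cA_near_wells (S : IsTubularSetting Ω T₀ Γ Ωp Ωm δ) (ht : t ∈ Icc 0 T₀)
    (hζ : IsCutoff δ ζ) {κ R M : ℝ} (hR1 : ∀ ρ, R ≤ ρ → |θ₀ ρ - 1| ≤ κ / 2)
    (hR2 : ∀ ρ, ρ ≤ -R → |θ₀ ρ + 1| ≤ κ / 2) (hε : 0 < ε) (hεR : R + M ≤ δ / ε)
    (hεM : ε ^ 2 * M ≤ κ / 2) (hh : ∀ p ∈ Γ t, |h p t| ≤ M) (hc : |c₂ x t| ≤ M)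
    (hx : x ∈ Ω) (hxδ : δ ≤ Metric.infDist x (Γ t)) :
    |cA θ₀ ζ Γ Ωp Ωm h c₂ ε x t - 1| ≤ κ ∨ |cA θ₀ ζ Γ Ωp Ωm h c₂ ε x t + 1| ≤ κ := by
  have hδ := S.width.pos
  have hxΓ : x ∉ Γ t := fun hxΓ => by
    have := (S.infDist_eq_zero_iff ht).2 hxΓ
    linarith
  have hmem : x ∈ Ωp t ∪ Ωm t := by rw [S.divided.union t ht]; exact ⟨hx, hxΓ⟩
  have hP := abs_le.1 (hh _ (S.proj_spec ht x).1)
  have hζx := hζ.mem_Icc hδ (sdist Γ Ωm x t)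
  have hcε : |ε ^ 2 * c₂ x t| ≤ κ / 2 := by
    rw [abs_mul, abs_of_nonneg (sq_nonneg ε)]
    exact (mul_le_mul_of_nonneg_left hc (sq_nonneg ε)).trans hεM
  have hdiv : δ / ε ≤ Metric.infDist x (Γ t) / ε := by gcongr
  have small : ∀ u, |u| ≤ κ / 2 → |ζ (sdist Γ Ωm x t) * u + ε ^ 2 * c₂ x t| ≤ κ := fun u hu => by
    refine (abs_add_le _ _).trans ?_
    rw [abs_mul, abs_of_nonneg hζx.1]
    have := mul_le_mul hζx.2 hu (abs_nonneg u) zero_le_one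
    linarith
  rcases hmem with hp | hm
  · have hnm := (S.divided.disjoint t ht).notMem_of_mem_left hp
    have hρ : R ≤ stretched Γ Ωm h ε x t := by
      rw [stretched, show sdist Γ Ωm x t = Metric.infDist x (Γ t) by simp [sdist, hnm]]
      linarith
    left
    convert small _ (hR1 _ hρ) using 2
    simp only [cA, cA₀, indicator_of_mem hp, indicator_of_notMem hnm]
    ring
  · have hnp := (S.divided.disjoint t ht).notMem_of_mem_right hm
    have hρ : stretched Γ Ωm h ε x t ≤ -R := by
      rw [stretched, show sdist Γ Ωm x t = -Metric.infDist x (Γ t) by simp [sdist, hm], neg_div]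
      linarith
    right
    convert small _ (hR2 _ hρ) using 2
    simp only [cA, cA₀, indicator_of_mem hm, indicator_of_notMem hnp]
    ring

lemma abs_cA_le (S : IsTubularSetting Ω T₀ Γ Ωp Ωm δ) (ht : t ∈ Icc 0 T₀)
    (hζ : IsCutoff δ ζ) {B M : ℝ} (hB : ∀ ρ, |θ₀ ρ| ≤ B) (hε : ε ^ 2 ≤ 1) (hc : |c₂ x t| ≤ M) :
    |cA θ₀ ζ Γ Ωp Ωm h c₂ ε x t| ≤ B + 1 + M := by
  have hζx := hζ.mem_Icc S.width.pos (sdist Γ Ωm x t)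
  have hi : |(Ωp t).indicator (fun _ => (1 : ℝ)) x - (Ωm t).indicator (fun _ => (1 : ℝ)) x| ≤ 1 := by
    by_cases hp : x ∈ Ωp t
    · simp [hp, (S.divided.disjoint t ht).notMem_of_mem_left hp]
    · by_cases hm : x ∈ Ωm t <;> simp [hp, hm]
  have h1 : |ζ (sdist Γ Ωm x t) * θ₀ (stretched Γ Ωm h ε x t)| ≤ 1 * B := by
    rw [abs_mul, abs_of_nonneg hζx.1]
    exact mul_le_mul hζx.2 (hB _) (abs_nonneg _) zero_le_one
  have h2 : |(1 - ζ (sdist Γ Ωm x t)) *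
      ((Ωp t).indicator (fun _ => (1 : ℝ)) x - (Ωm t).indicator (fun _ => (1 : ℝ)) x)| ≤ 1 * 1 := by
    rw [abs_mul, abs_of_nonneg (by linarith [hζx.2])]
    exact mul_le_mul (by linarith [hζx.1]) hi (abs_nonneg _) zero_le_one
  have h3 : |ε ^ 2 * c₂ x t| ≤ 1 * M := by
    rw [abs_mul, abs_of_nonneg (sq_nonneg ε)]
    exact mul_le_mul hε hc (abs_nonneg _) zero_le_one
  refine (abs_add_le _ _).trans ?_
  have := abs_add_le (ζ (sdist Γ Ωm x t) * θ₀ (stretched Γ Ωm h ε x t))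
    ((1 - ζ (sdist Γ Ωm x t)) *
      ((Ωp t).indicator (fun _ => (1 : ℝ)) x - (Ωm t).indicator (fun _ => (1 : ℝ)) x))
  unfold cA₀
  linarith

/-- For fixed `ε` and `t`, the height function may be replaced by a smooth one at the cost of an
error of order `ε²` in the profile. -/
lemma exists_smoothStretched (S : IsTubularSetting Ω T₀ Γ Ωp Ωm δ) (ht : t ∈ Icc 0 T₀)
    (hθ : Continuous θ₀) (hh : ContinuousOn (fun q : E × ℝ => h q.1 q.2) (spaceTime Γ T₀))
    {M : ℝ} (hM : ∀ p ∈ Γ t, |h p t| ≤ M) (hε : 0 < ε) :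
    ∃ b : E → ℝ, ContDiff ℝ ∞ b ∧ ∀ x, Metric.infDist x (Γ t) ≤ δ →
      |smoothStretched Γ Ωm b ε t x - sdist Γ Ωm x t / ε| ≤ M + 1 ∧
      |θ₀ (stretched Γ Ωm h ε x t) - θ₀ (smoothStretched Γ Ωm b ε t x)| ≤ ε ^ 2 := by
  have hδ := S.width.pos
  set A := δ / ε + (M + 1) with hA
  have huc := isCompact_Icc.uniformContinuousOn_of_continuous (hθ.continuousOn (s := Icc (-A) A))
  obtain ⟨η, hη, hηθ⟩ := Metric.uniformContinuousOn_iff.1 huc (ε ^ 2) (by positivity)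
  have hhc : ContinuousOn (fun p => h p t) (Γ t) :=
    hh.comp (f := fun p : E => (p, t)) (by fun_prop) fun p hp => ⟨ht, hp⟩
  obtain ⟨b, hb, hbh⟩ := exists_contDiff_approx_on (S.isCompact ht).isClosed hhc
    (lt_min hη one_pos)
  refine ⟨b, hb, fun x hx => ?_⟩
  have hxt : x ∈ tube Ω Γ (3 * δ) t := S.mem_tube ht (by linarith) (by linarith)
  have hp := (S.proj_spec ht x).1
  have e : smoothStretched Γ Ωm b ε t x = sdist Γ Ωm x t / ε - b (proj Γ x t) := by
    rw [smoothStretched, S.proj_eq_sub ht hxt]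
  have h1 := hbh _ hp
  have h2 := abs_lt.1 (h1.trans_le (min_le_right _ _))
  have h3 := abs_le.1 (hM _ hp)
  have h4 : |sdist Γ Ωm x t / ε| ≤ δ / ε := by
    rw [abs_div, abs_sdist, abs_of_pos hε]
    gcongr
  have h5 := abs_le.1 h4
  refine ⟨?_, ?_⟩
  · rw [e, abs_le]
    constructor <;> linarith
  · have := hηθ (stretched Γ Ωm h ε x t) ⟨by rw [stretched]; linarith, by rw [stretched]; linarith⟩
      (smoothStretched Γ Ωm b ε t x) ⟨by rw [e]; linarith, by rw [e]; linarith⟩ (by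
        rw [e, stretched, Real.dist_eq]
        refine lt_of_eq_of_lt ?_ (h1.trans_le (min_le_left _ _))
        congr 1
        ring)
    rw [Real.dist_eq] at this
    exact this.le

end IsTubularSetting

end Approximate

/-! ### The spectral estimate -/

section Potential

variable {Ω : Set (EuclideanSpace ℝ (Fin d))} {T₀ : ℝ} {f θ₀ ζ : ℝ → ℝ}
  {Γ Ωp Ωm : ℝ → Set (EuclideanSpace ℝ (Fin d))} {δ ε t : ℝ} {x : EuclideanSpace ℝ (Fin d)}
  {h c₂ : EuclideanSpace ℝ (Fin d) → ℝ → ℝ} {b : EuclideanSpace ℝ (Fin d) → ℝ}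

namespace IsTubularSetting

/-- Cutting off the potential `f''(θ₀(ρ))` away from `Γ_t` only decreases it, because it is
nonnegative wherever `|ρ|` is large. -/
lemma cos_sq_mul_potential_le (S : IsTubularSetting Ω T₀ Γ Ωp Ωm δ) {R M : ℝ}
    (hR : ∀ ρ, R ≤ ρ ∨ ρ ≤ -R → 0 ≤ deriv (deriv f) (θ₀ ρ)) (hε : 0 < ε)
    (hεR : 2 * (R + M + 1) ≤ δ / ε)
    (hb : |smoothStretched Γ Ωm b ε t x - sdist Γ Ωm x t / ε| ≤ M + 1) :
    Real.cos (cutAngle δ (sdist Γ Ωm x t)) ^ 2 *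
        (ε⁻¹ ^ 2 * deriv (deriv f) (θ₀ (smoothStretched Γ Ωm b ε t x))) ≤
      ε⁻¹ ^ 2 * deriv (deriv f) (θ₀ (smoothStretched Γ Ωm b ε t x)) := by
  by_cases hs : |sdist Γ Ωm x t| ≤ δ / 2
  · rw [cutAngle_eq_zero S.width.pos hs, Real.cos_zero]
    simp
  · have hb' := abs_le.1 hb
    have key : R ≤ smoothStretched Γ Ωm b ε t x ∨ smoothStretched Γ Ωm b ε t x ≤ -R := by
      have e2 : δ / 2 / ε = δ / ε / 2 := by ring
      rcases abs_cases (sdist Γ Ωm x t) with ⟨e, -⟩ | ⟨e, -⟩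
      · have : δ / 2 / ε ≤ sdist Γ Ωm x t / ε := by gcongr; linarith
        left; linarith
      · have : δ / 2 / ε ≤ -sdist Γ Ωm x t / ε := by gcongr; linarith
        rw [neg_div] at this
        right; linarith
    exact mul_le_of_le_one_left (mul_nonneg (sq_nonneg _) (hR _ key)) (Real.cos_sq_le_one _)

/-- Inside the tube the potentials at the profile and at the approximate solution differ by a
bounded amount. -/
lemma potential_le (hζ : IsCutoff δ ζ) {A M : ℝ} {L : NNReal}
    (hL : LipschitzOnWith L (deriv (deriv f)) (Icc (-A) A)) (hε : 0 < ε)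
    (hx : Metric.infDist x (Γ t) ≤ δ) (hc : |c₂ x t| ≤ M)
    (hcA : |cA θ₀ ζ Γ Ωp Ωm h c₂ ε x t| ≤ A) (hθA : ∀ ρ, |θ₀ ρ| ≤ A)
    (hb : |θ₀ (stretched Γ Ωm h ε x t) - θ₀ (smoothStretched Γ Ωm b ε t x)| ≤ ε ^ 2) :
    ε⁻¹ ^ 2 * deriv (deriv f) (θ₀ (smoothStretched Γ Ωm b ε t x)) ≤
      (ε ^ 2)⁻¹ * deriv (deriv f) (cA θ₀ ζ Γ Ωp Ωm h c₂ ε x t) + L * (M + 1) := by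
  have h1 := hL.dist_le_mul _ (abs_le.1 (hθA (smoothStretched Γ Ωm b ε t x))) _ (abs_le.1 hcA)
  rw [Real.dist_eq, Real.dist_eq] at h1
  have h2 : |θ₀ (smoothStretched Γ Ωm b ε t x) - cA θ₀ ζ Γ Ωp Ωm h c₂ ε x t| ≤
      ε ^ 2 * (M + 1) := by
    rw [cA_of_infDist_le hζ hx, show θ₀ (smoothStretched Γ Ωm b ε t x) -
      (θ₀ (stretched Γ Ωm h ε x t) + ε ^ 2 * c₂ x t) = -(θ₀ (stretched Γ Ωm h ε x t) -
        θ₀ (smoothStretched Γ Ωm b ε t x)) + -(ε ^ 2 * c₂ x t) by ring]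
    refine (abs_add_le _ _).trans ?_
    rw [abs_neg, abs_neg, abs_mul, abs_of_nonneg (sq_nonneg ε)]
    have := mul_le_mul_of_nonneg_left hc (sq_nonneg ε)
    linarith
  have h3 := (le_abs_self _).trans (h1.trans (mul_le_mul_of_nonneg_left h2 L.coe_nonneg))
  have h4 := mul_le_mul_of_nonneg_left h3 (inv_nonneg.2 (sq_nonneg ε))
  have h5 : (ε ^ 2)⁻¹ * (L * (ε ^ 2 * (M + 1))) = L * (M + 1) := by field_simp
  rw [mul_sub, h5] at h4
  rw [inv_pow]
  linarith

end IsTubularSetting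

end Potential

end Space

end AllenCahn

theorem mainTheorem3 {d : ℕ} (hd : 2 ≤ d)
    (f θ₀ : ℝ → ℝ) (hf : AllenCahn.IsDoubleWell f) (hθ₀ : AllenCahn.IsOptimalProfile f θ₀)
    (Ω : Set (EuclideanSpace ℝ (Fin d)))
    (hΩo : IsOpen Ω) (hΩc : IsConnected Ω) (hΩb : Bornology.IsBounded Ω)
    (T₀ : ℝ) (hT₀ : 0 < T₀)
    (Γ Ωp Ωm : ℝ → Set (EuclideanSpace ℝ (Fin d)))
    (hΓ : AllenCahn.IsEvolvingHypersurface Ω T₀ Γ) (hdiv : AllenCahn.IsDivided Ω T₀ Γ Ωp Ωm)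
    (δ : ℝ) (hδ : AllenCahn.IsTubeWidth Ω T₀ Γ Ωm δ)
    (M : ℝ) (hM : 0 < M) :
    ∃ C ε₀ : ℝ, 0 < C ∧ 0 < ε₀ ∧ ε₀ < 1 ∧
      ∀ ζ : ℝ → ℝ, AllenCahn.IsCutoff δ ζ →
      ∀ h c₂ : ℝ → EuclideanSpace ℝ (Fin d) → ℝ → ℝ,
      (∀ ε ∈ Set.Ioo (0 : ℝ) 1,
        ContinuousOn (fun q : EuclideanSpace ℝ (Fin d) × ℝ => h ε q.1 q.2)
          (AllenCahn.spaceTime Γ T₀)) →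
      (∀ ε ∈ Set.Ioo (0 : ℝ) 1, ∀ t ∈ Set.Icc 0 T₀,
        MeasureTheory.AEStronglyMeasurable (fun x => c₂ ε x t)
          (MeasureTheory.volume.restrict Ω)) →
      (∀ ε ∈ Set.Ioo (0 : ℝ) 1, ∀ q ∈ AllenCahn.spaceTime Γ T₀, ∀ x ∈ Ω, ∀ t ∈ Set.Icc 0 T₀,
        |h ε q.1 q.2| + |c₂ ε x t| ≤ M) →
      ∀ (ψ : EuclideanSpace ℝ (Fin d) → ℝ)
        (G : EuclideanSpace ℝ (Fin d) → EuclideanSpace ℝ (Fin d)), AllenCahn.IsH1 Ω ψ G →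
      ∀ t ∈ Set.Icc 0 T₀, ∀ ε ∈ Set.Ioc 0 ε₀,
        -C * (∫ x in Ω, ψ x ^ 2)
            + (∫ x in Ω \ AllenCahn.tube Ω Γ δ t, ‖G x‖ ^ 2)
            + (∫ x in AllenCahn.tube Ω Γ δ t, ‖AllenCahn.tangential Γ Ωm x t (G x)‖ ^ 2)
          ≤ (∫ x in Ω, (‖G x‖ ^ 2 + (ε ^ 2)⁻¹ *
              deriv (deriv f) (AllenCahn.cA θ₀ ζ Γ Ωp Ωm (h ε) (c₂ ε) ε x t) * ψ x ^ 2)) := by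
  have S : AllenCahn.IsTubularSetting Ω T₀ Γ Ωp Ωm δ := ⟨hΩo, hΓ, hdiv, hδ⟩
  have hδ0 := hδ.pos
  obtain ⟨κ, hκ, hwell⟩ := hf.exists_deriv2_nonneg
  obtain ⟨R, hR0, hR1, hR2⟩ := hθ₀.exists_near_wells (half_pos hκ)
  obtain ⟨B, hB⟩ := hθ₀.exists_bound
  have hθc : Continuous θ₀ := hθ₀.contDiff.continuous
  set A := B + 1 + M with hA
  have hB0 : 0 ≤ B := (abs_nonneg _).trans (hB 0)
  have hf2 : ContDiff ℝ ∞ (deriv (deriv f)) := hf.contDiff_deriv2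
  obtain ⟨L, hL⟩ := (hf2.of_le (n := ∞) (m := 1) (by simp)).locallyLipschitz.locallyLipschitzOn
    |>.exists_lipschitzOnWith_of_compact (isCompact_Icc (a := -A) (b := A))
  obtain ⟨Q, hQ⟩ := isCompact_Icc.exists_bound_of_continuousOn
    (hf2.continuous.continuousOn (s := Icc (-A) A))
  obtain ⟨K, hK0, hK⟩ := S.exists_bound_fderiv_lapSdist
  obtain ⟨β, hβ⟩ := isCompact_Icc.exists_bound_of_continuousOn
    (((AllenCahn.contDiff_cutAngle δ).continuous_deriv (by simp)).continuousOn
      (s := Icc (-δ) δ))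
  have hLM : 0 ≤ (L : ℝ) * (M + 1) := by positivity
  -- The last two bounds on `ε` make `|ρ| ≥ R` hold at distance `δ/2` from the interface, and
  -- `|ε² c₂| ≤ κ/2`.
  refine ⟨β ^ 2 + K + L * (M + 1) + 1,
    min (1 / 2) (min (δ / (2 * (R + M + 1))) (κ / (2 * M))), by positivity, by positivity,
    (min_le_left _ _).trans_lt (by norm_num), ?_⟩
  intro ζ hζ h c₂ hhc hcm hhM ψ G hψ t ht ε hε
  have hε0 : 0 < ε := hε.1
  have hε1 : ε < 1 := (hε.2.trans (min_le_left _ _)).trans_lt (by norm_num)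
  have hεI : ε ∈ Ioo (0 : ℝ) 1 := ⟨hε0, hε1⟩
  have hεR : 2 * (R + M + 1) ≤ δ / ε := by
    have h1 := (hε.2.trans (min_le_right _ _)).trans (min_le_left _ _)
    rw [le_div_iff₀ (by positivity)] at h1
    rw [le_div_iff₀ hε0]
    linarith
  have hε2 : ε ^ 2 ≤ ε := by nlinarith
  have hεM : ε ^ 2 * M ≤ κ / 2 := by
    have h1 := (hε.2.trans (min_le_right _ _)).trans (min_le_right _ _)
    rw [le_div_iff₀ (by positivity)] at h1
    nlinarith
  have hhM' : ∀ p ∈ Γ t, |h ε p t| ≤ M := fun p hp => by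
    have := hhM ε hεI (p, t) ⟨ht, hp⟩ p (hΓ.subset t ht hp) t ht
    linarith [abs_nonneg (c₂ ε p t)]
  have hcM' : ∀ x ∈ Ω, |c₂ ε x t| ≤ M := fun x hx => by
    obtain ⟨p, hp⟩ := hΓ.nonempty t ht
    have := hhM ε hεI (p, t) ⟨ht, hp⟩ x hx t ht
    linarith [abs_nonneg (h ε p t)]
  obtain ⟨b, hb, hbρ⟩ := S.exists_smoothStretched ht hθc (hhc ε hεI) hhM' hε0
  have hcA : ∀ x ∈ Ω, |AllenCahn.cA θ₀ ζ Γ Ωp Ωm (h ε) (c₂ ε) ε x t| ≤ A := fun x hx =>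
    S.abs_cA_le ht hζ hB (hε2.trans hε1.le) (hcM' x hx)
  refine S.calibration ht hψ (g := AllenCahn.fieldWeight θ₀ Γ Ωm δ b ε t)
    (W := fun x => (ε ^ 2)⁻¹ *
      deriv (deriv f) (AllenCahn.cA θ₀ ζ Γ Ωp Ωm (h ε) (c₂ ε) ε x t))
    (fun x hx => S.contDiffAt_fieldWeight ht hf hθ₀ hx hb)
    (fun x hx => S.fieldWeight_eq_zero hx) ?_ (fun x hx => ?_) (fun x hxΩ hx => ?_)
  · refine hψ.memLp.integrable_sq.bdd_mul (c := (ε ^ 2)⁻¹ * Q)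
      ((hf2.continuous.comp_aestronglyMeasurable
        (S.aestronglyMeasurable_cA ht hθc hζ (hhc ε hεI) (hcm ε hεI t ht))).const_mul _) ?_
    filter_upwards [ae_restrict_mem hΩo.measurableSet] with x hx
    rw [norm_mul, Real.norm_of_nonneg (by positivity)]
    exact mul_le_mul_of_nonneg_left (hQ _ (abs_le.1 (hcA x hx))) (by positivity)
  · have hxt : x ∈ AllenCahn.tube Ω Γ (3 * δ) t := S.mem_tube ht (by linarith) (by linarith)
    obtain ⟨h1, h2⟩ := hbρ x hx
    have e1 := S.fderiv_fieldWeight_add_le (ε := ε) ht hf hθ₀ hxt hb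
    have e2 := S.cos_sq_mul_potential_le (f := f) (θ₀ := θ₀)
      (fun ρ hρ => hwell _ (hρ.imp
        (fun h => (hR1 ρ h).trans (by linarith)) fun h => (hR2 ρ h).trans (by linarith)))
      hε0 hεR h1
    have e3 := AllenCahn.IsTubularSetting.potential_le (Ωp := Ωp) (b := b) hζ hL hε0 hx
      (hcM' x hxt.1) (hcA x hxt.1) (fun ρ => (hB ρ).trans (by linarith)) h2
    have e4 := hK t ht x hx
    have e5 : deriv (AllenCahn.cutAngle δ) (AllenCahn.sdist Γ Ωm x t) ^ 2 ≤ β ^ 2 := by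
      have := hβ (AllenCahn.sdist Γ Ωm x t) (abs_le.1 (by rwa [AllenCahn.abs_sdist]))
      rw [Real.norm_eq_abs] at this
      exact sq_le_sq.2 (this.trans (le_abs_self β))
    linarith
  · have hw := hwell _ (S.cA_near_wells ht hζ hR1 hR2 hε0 (by linarith) hεM hhM'
      (hcM' x hxΩ) hxΩ hx.le)
    have : 0 ≤ (ε ^ 2)⁻¹ * deriv (deriv f) (AllenCahn.cA θ₀ ζ Γ Ωp Ωm (h ε) (c₂ ε) ε x t) :=
      mul_nonneg (by positivity) hw
    have : 0 ≤ β ^ 2 := sq_nonneg β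
    linarith
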